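/- **Fooling geometric concepts with low intrinsic dimension.** *Definitions.* A concept on $\mathbb R^d$ is a Borel function $f:\mathbb R^d\to\{\pm1\}$. For $\rho\ge 0$ put $f^{+\rho}(x)=\sup_{\|z\|_2\le\rho}f(x+z)$ and $f^{-\rho}(x)=\inf_{\|z\|_2\le\rho}f(x+z)$. Given a probability distribution $\mathcal D$ on $\mathbb R^d$, $f$ has $\sigma$-smooth boundary with respect to $\mathcal D$ if $\mathbb E_{x\sim\mathcal D}\big[\tfrac12(f^{+\rho}(x)-f^{-\rho}(x))\big]\le\sigma\rho$ for all $\rho\ge0$. The distribution $\mathcal D$ is $\gamma$-strictly subexponential with parameters $\alpha,\beta>0$ if $\Pr_{x\sim\mathcal D}[|w\cdot x|\ge r]\le\alpha\exp(-\beta r^{1+\gamma})$ for all unit vectors $w$ and all $r\ge0$. A class $\mathcal F$ of concepts on $\mathbb R^d$ and a distribution $\mathcal D$ on $\mathbb R^d$ form a *valid instance* with parameters $k\le d$, $\sigma\ge1$, $\gamma>0$ (and tail parameters $\alpha,\beta$) if every $f\in\mathcal F$ can be written as $f(x)=F(Wx)$ with $F:\mathbb R^k\to\{\pm1\}$, $W\in\mathbb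 R^{k\times d}$, $WW^\top=I_{k\times k}$, every $f\in\mathcal F$ has $\sigma$-smooth boundary with respect to $\mathcal D$, and $\mathcal D$ is $\gamma$-strictly subexponential with parameters $\alpha,\beta$. For $\ell\in\mathbb N$ and $\Delta\ge0$, $(\ell,\Delta)$-moment matching $\varepsilon'$-fools $\mathcal F$ with respect to $\mathcal D$ if $|\mathbb E_{\mathcal D}[f]-\mathbb E_{\mathcal D'}[f]|\le\varepsilon'$ for all $f\in\mathcal F$ and every probability distribution $\mathcal D'$ on $\mathbb R^d$ whose moments of degree at most $\ell$ exist and satisfy $|\mathbb E_{\mathcal D}[x^a]-\mathbb E_{\mathcal D'}[x^a]|\le\Delta$ for all $a\in\mathbb N^d$ with $\|a\|_1\le\ell$. *Theorem.* There is a universal constant $c\in\mathbb N$, and for all $\alpha,\beta,\gamma>0$ there is a constant $C=C(\alpha,\beta,\gamma)>0$, such that the following holds. Let $\mathcal F,\mathcal D$ be a valid instance on $\mathbb R^d$ with parameters $k,\sigma,\gamma,\alpha,\beta$, let $\varepsilon\in(0,1)$, and put $X=\sigma k^{3/2}/\varepsilon^2$. Then there are $\ell\in\mathbb N$ and $B\ge0$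 with $$\ell\le\big(C\,X\,(1+\log X)^c\big)^{1+1/\gamma},\qquad B\le\exp\Big(\big(C\,X\,(1+\log X)^c\big)^{1+1/\gamma}\,(1+\log d)^c\Big)$$ such that for every $\Delta\ge0$, $(\ell,\Delta)$-moment matching $(\varepsilon+\Delta B)$-fools $\mathcal F$ with respect to $\mathcal D$. (In short, $\ell\le\widetilde O(\sigma k^{3/2}/\varepsilon^2)^{1+1/\gamma}$ and $B\le\exp\big(\widetilde O(\sigma k^{3/2}/\varepsilon^2)^{1+1/\gamma}\cdot\mathrm{poly}(\log d)\big)$; for $k=0$, $\log 0$ is read as $0$ and $X\log X$ as $0$, and for $d=0$ likewise.) -/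

import Mathlib

open MeasureTheory

noncomputable section

/-- `f : ℝ^n → {±1}`, seen as a (Borel measurable) real-valued function. -/
structure IsConcept {n : ℕ} (f : EuclideanSpace ℝ (Fin n) → ℝ) : Prop where
  range : ∀ x, f x = -1 ∨ f x = 1
  measurable : Measurable f

/-- The dilation `f^{+ρ}(x) = sup_{‖z‖₂ ≤ ρ} f(x + z)`. -/
def dilation {n : ℕ} (f : EuclideanSpace ℝ (Fin n) → ℝ) (ρ : ℝ)
    (x : EuclideanSpace ℝ (Fin n)) : ℝ :=
  ⨆ z : {z : EuclideanSpace ℝ (Fin n) // ‖z‖ ≤ ρ}, f (x + z)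

/-- The erosion `f^{-ρ}(x) = inf_{‖z‖₂ ≤ ρ} f(x + z)`. -/
def erosion {n : ℕ} (f : EuclideanSpace ℝ (Fin n) → ℝ) (ρ : ℝ)
    (x : EuclideanSpace ℝ (Fin n)) : ℝ :=
  ⨅ z : {z : EuclideanSpace ℝ (Fin n) // ‖z‖ ≤ ρ}, f (x + z)

/-- `f` has `σ`-smooth boundary with respect to `D`: `E_D[(f^{+ρ} - f^{-ρ}) / 2] ≤ σ ρ` for every
`ρ ≥ 0`. The expectation is that of a nonnegative function. -/
def HasSmoothBoundary {n : ℕ} (f : EuclideanSpace ℝ (Fin n) → ℝ) (σ : ℝ)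
    (D : Measure (EuclideanSpace ℝ (Fin n))) : Prop :=
  ∀ ρ : ℝ, 0 ≤ ρ →
    ∫⁻ x, ENNReal.ofReal ((dilation f ρ x - erosion f ρ x) / 2) ∂D ≤ ENNReal.ofReal (σ * ρ)

/-- `D` is `γ`-strictly subexponential with parameters `α, β`. -/
def IsStrictlySubexponential {n : ℕ} (D : Measure (EuclideanSpace ℝ (Fin n)))
    (γ α β : ℝ) : Prop :=
  ∀ w : EuclideanSpace ℝ (Fin n), ‖w‖ = 1 → ∀ r : ℝ, 0 ≤ r →
    D.real {x | r ≤ |inner ℝ w x|} ≤ α * Real.exp (-β * r ^ (1 + γ))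

/-- `f(x) = F(W x)` for some `F : ℝ^k → {±1}` and some `W ∈ ℝ^{k × n}` with `W Wᵀ = I`.
(If `f` is measurable, so is `F`.) -/
def HasIntrinsicDimension {n : ℕ} (f : EuclideanSpace ℝ (Fin n) → ℝ) (k : ℕ) : Prop :=
  ∃ (F : EuclideanSpace ℝ (Fin k) → ℝ) (W : Matrix (Fin k) (Fin n) ℝ),
    (∀ y, F y = -1 ∨ F y = 1) ∧ W * W.transpose = 1 ∧
      ∀ x : EuclideanSpace ℝ (Fin n), f x = F (WithLp.toLp 2 (W.mulVec x.ofLp))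

/-- The valid instances: a concept class `𝓕` and a distribution `D` over `ℝ^d` with parameters
`k, σ, γ` (and tail parameters `α, β`). -/
structure IsValidInstance {d : ℕ} (𝓕 : Set (EuclideanSpace ℝ (Fin d) → ℝ))
    (D : Measure (EuclideanSpace ℝ (Fin d))) (k : ℕ) (σ γ α β : ℝ) : Prop where
  isConcept : ∀ f ∈ 𝓕, IsConcept f
  intrinsicDimension : ∀ f ∈ 𝓕, HasIntrinsicDimension f k
  smoothBoundary : ∀ f ∈ 𝓕, HasSmoothBoundary f σ D
  subexponential : IsStrictlySubexponential D γ α β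

/-- The monomial `x^a = ∏ i, x_i ^ a_i`. -/
def monomialFun {d : ℕ} (a : Fin d → ℕ) (x : EuclideanSpace ℝ (Fin d)) : ℝ :=
  ∏ i, x i ^ a i

/-- `D'` belongs to `MM_D(ℓ, Δ)`: it is a probability distribution whose moments of total degree at
most `ℓ` exist and differ from those of `D` by at most `Δ`. -/
structure IsMomentMatching {d : ℕ} (D : Measure (EuclideanSpace ℝ (Fin d))) (ℓ : ℕ) (Δ : ℝ)
    (D' : Measure (EuclideanSpace ℝ (Fin d))) : Prop where
  isProbabilityMeasure : IsProbabilityMeasure D'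
  integrable_left : ∀ a : Fin d → ℕ, ∑ i, a i ≤ ℓ → Integrable (monomialFun a) D
  integrable_right : ∀ a : Fin d → ℕ, ∑ i, a i ≤ ℓ → Integrable (monomialFun a) D'
  abs_sub_le : ∀ a : Fin d → ℕ, ∑ i, a i ≤ ℓ →
    |∫ x, monomialFun a x ∂D - ∫ x, monomialFun a x ∂D'| ≤ Δ

/-- `(ℓ, Δ)`-moment matching `ε`-fools the class `𝓕` with respect to `D`. -/
def MomentMatchingFools {d : ℕ} (𝓕 : Set (EuclideanSpace ℝ (Fin d) → ℝ))
    (D : Measure (EuclideanSpace ℝ (Fin d))) (ℓ : ℕ) (Δ ε : ℝ) : Prop :=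
  ∀ D' : Measure (EuclideanSpace ℝ (Fin d)), IsMomentMatching D ℓ Δ D' →
    ∀ f ∈ 𝓕, |∫ x, f x ∂D - ∫ x, f x ∂D'| ≤ ε

/-- `(C · X · (1 + log X)^c)^{1 + 1/γ}`, the explicit form of `Õ(X)^{1 + 1/γ}`. -/
def softOPow (C : ℝ) (c : ℕ) (γ X : ℝ) : ℝ :=
  (C * X * (1 + Real.log X) ^ c) ^ (1 + 1 / γ)

end

/-! It suffices to find, for each concept `f`, a polynomial `P ≥ f` of degree at most `ℓ` with
`E_D[P] ≤ E_D[f] + ε` and coefficient `ℓ¹` norm at most `B`: then `E_{D'}[f] ≤ E_{D'}[P] ≤ E_D[P] +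
ΔB ≤ E_D[f] + ε + ΔB`. The class of admissible `f` is closed under negation, which gives the other
inequality.

To build `P`, write `f = F ∘ W` and replace `F` by its sup-convolution `G`, a Lipschitz majorant
with `G ∘ W ≤ f^{+ρ}`. Smoothness of the boundary makes the cost at most `2σρ`
(`integral_supConv_comp_le`). On the cube `[-r, r]^k`, `G` is approximated by a tensor product of
Jackson-type kernels, a polynomial of degree `m = 4kq` with error of order `Lip(G) · r√k / q`
(`abs_jackson_sub_le`). Outside the cube, this polynomial is bounded through its coefficients, so
the error there is dominated by `2 ∑ (5 y_i / r) ^ m`, where `y = W x` (`abs_jackson_sub_le_add`).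
Adding both error bounds to the approximant yields `P`.

Strict subexponentiality bounds the `m`-th moments by about `m ^ (m / (1 + γ))`, so a radius `r` of
order `m ^ (1 / (1 + γ))` makes the tail term small. The cube error is then small once `m ^ (γ / (1
+ γ))` exceeds a multiple of `X`, i.e. `m` is of order `X ^ (1 + 1/γ)` (`exists_degree_and_radius`).
-/

/-! ### One variable: a discretised Jackson-type kernel. -/

/-- The trigonometric kernel `|∑ j < J, a j * exp (i j t)| ^ 2`, expanded. -/
noncomputable def trigKernel (a : ℕ → ℝ) (J : ℕ) (t : ℝ) : ℝ :=
  ∑ i ∈ Finset.range J, ∑ j ∈ Finset.range J, a i * a j * Real.cos (((i : ℝ) - j) * t)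

/-- The phase `s` is free because a factor `exp (i s)` does not change the modulus. -/
lemma trigKernel_eq_sq_add_sq (a : ℕ → ℝ) (J : ℕ) (t s : ℝ) :
    trigKernel a J t = (∑ j ∈ Finset.range J, a j * Real.cos (j * t + s)) ^ 2 +
      (∑ j ∈ Finset.range J, a j * Real.sin (j * t + s)) ^ 2 := by
  rw [trigKernel, sq, sq, Finset.sum_mul_sum, Finset.sum_mul_sum, ← Finset.sum_add_distrib]
  refine Finset.sum_congr rfl fun i _ ↦ ?_
  rw [← Finset.sum_add_distrib]
  refine Finset.sum_congr rfl fun j _ ↦ ?_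
  have : ((i : ℝ) - j) * t = (i * t + s) - (j * t + s) := by ring
  rw [this, Real.cos_sub]
  ring

lemma trigKernel_nonneg (a : ℕ → ℝ) (J : ℕ) (t : ℝ) : 0 ≤ trigKernel a J t := by
  rw [trigKernel_eq_sq_add_sq a J t 0]
  positivity

/-- Summation by parts: `2 - 2 cos t = |1 - exp (i t)| ^ 2`, and multiplying a trigonometric sum
with vanishing end coefficients by `1 - exp (i t)` differences its coefficients. -/
lemma trigKernel_mul_two_sub (a : ℕ → ℝ) (J : ℕ) (h0 : a 0 = 0) (hJ : a J = 0) (t : ℝ) :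
    trigKernel a J t * (2 - 2 * Real.cos t) = trigKernel (fun j ↦ a (j + 1) - a j) J t := by
  have shift (g : ℕ → ℝ) : ∑ j ∈ Finset.range J, a (j + 1) * g (j + 1) =
      ∑ j ∈ Finset.range J, a j * g j := by
    have h1 := Finset.sum_range_succ (fun j ↦ a j * g j) J
    rw [Finset.sum_range_succ' (fun j ↦ a j * g j) J] at h1
    simpa [h0, hJ] using h1
  rw [trigKernel_eq_sq_add_sq a J t 0, trigKernel_eq_sq_add_sq _ J t t]
  simp only [add_zero, sub_mul, Finset.sum_sub_distrib]
  have hc := shift (fun j ↦ Real.cos (j * t))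
  have hs := shift (fun j ↦ Real.sin (j * t))
  have e (j : ℕ) : ((j + 1 : ℕ) : ℝ) * t = j * t + t := by push_cast; ring
  simp only [e] at hc hs
  rw [hc, hs]
  have hc' : ∑ j ∈ Finset.range J, a j * Real.cos (j * t + t) =
      (∑ j ∈ Finset.range J, a j * Real.cos (j * t)) * Real.cos t -
      (∑ j ∈ Finset.range J, a j * Real.sin (j * t)) * Real.sin t := by
    rw [Finset.sum_mul, Finset.sum_mul, ← Finset.sum_sub_distrib]
    exact Finset.sum_congr rfl fun j _ ↦ by rw [Real.cos_add]; ring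
  have hs' : ∑ j ∈ Finset.range J, a j * Real.sin (j * t + t) =
      (∑ j ∈ Finset.range J, a j * Real.sin (j * t)) * Real.cos t +
      (∑ j ∈ Finset.range J, a j * Real.cos (j * t)) * Real.sin t := by
    rw [Finset.sum_mul, Finset.sum_mul, ← Finset.sum_add_distrib]
    exact Finset.sum_congr rfl fun j _ ↦ by rw [Real.sin_add]; ring
  rw [hc', hs']
  linear_combination (-(∑ j ∈ Finset.range J, a j * Real.cos (j * t)) ^ 2 -
      (∑ j ∈ Finset.range J, a j * Real.sin (j * t)) ^ 2) * Real.sin_sq_add_cos_sq t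

/-- Real part of a geometric sum over a nontrivial `M`-th root of unity; `|m| < M` excludes
aliasing. -/
lemma sum_cos_int_mul_sub_grid {M : ℕ} {m : ℤ} (hm : m ≠ 0) (hmM : |m| < M) (θ : ℝ) :
    ∑ s ∈ Finset.range M, Real.cos (m * (θ - 2 * Real.pi * s / M)) = 0 := by
  have hM : (M : ℂ) ≠ 0 := by
    have : (0 : ℤ) < M := (abs_nonneg m).trans_lt hmM
    exact_mod_cast this.ne'
  set ζ : ℂ := Complex.exp (-(2 * Real.pi * m / M) * Complex.I) with hζ
  have hpow : ζ ^ M = 1 := by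
    rw [hζ, ← Complex.exp_nat_mul, Complex.exp_eq_one_iff]
    exact ⟨-m, by push_cast; field_simp⟩
  have hne : ζ ≠ 1 := by
    rw [hζ, Ne, Complex.exp_eq_one_iff]
    rintro ⟨n, hn⟩
    have h2 : (m : ℂ) = -n * M := by
      have := Complex.two_pi_I_ne_zero
      field_simp at hn
      have h3 : (2 * Real.pi * Complex.I) * (m : ℂ) = (2 * Real.pi * Complex.I) * (-n * M) := by
        linear_combination (-2 * Real.pi * Complex.I) * hn
      exact mul_left_cancel₀ this h3
    have h3 : m = -n * M := by exact_mod_cast h2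
    have hdvd : (M : ℤ) ∣ m := ⟨-n, by rw [h3]; ring⟩
    exact hm (Int.eq_zero_of_abs_lt_dvd hdvd hmM)
  have hsum : ∑ s ∈ Finset.range M, ζ ^ s = 0 := by
    have := mul_geom_sum ζ M
    rw [hpow, sub_self] at this
    exact (mul_eq_zero.mp this).resolve_left (sub_ne_zero.mpr hne)
  have key : ∑ s ∈ Finset.range M, Complex.exp ((m * (θ - 2 * Real.pi * s / M) : ℝ) * Complex.I)
      = 0 := by
    rw [← mul_zero (Complex.exp (m * θ * Complex.I)), ← hsum, Finset.mul_sum]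
    refine Finset.sum_congr rfl fun s _ ↦ ?_
    rw [hζ, ← Complex.exp_nat_mul, ← Complex.exp_add]
    congr 1
    push_cast
    ring
  have := congrArg Complex.re key
  simpa only [Complex.re_sum, Complex.exp_ofReal_mul_I_re, Complex.zero_re] using this

/-- All frequencies `i - j` are below `M` in modulus, so the grid sum keeps exactly the diagonal, as
an integral over the circle would. -/
lemma sum_trigKernel_grid (a : ℕ → ℝ) (M : ℕ) (θ : ℝ) :
    ∑ s ∈ Finset.range M, trigKernel a M (θ - 2 * Real.pi * s / M) =
      M * ∑ j ∈ Finset.range M, a j ^ 2 := by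
  simp only [trigKernel]
  rw [Finset.sum_comm, Finset.mul_sum]
  refine Finset.sum_congr rfl fun i hi ↦ ?_
  rw [Finset.sum_comm, Finset.sum_eq_single i]
  · simp [sq]
  · intro j hj hji
    rw [← Finset.mul_sum]
    have h := sum_cos_int_mul_sub_grid (M := M) (m := (i : ℤ) - j)
      (by omega) (by rw [Finset.mem_range] at hi hj; rw [abs_lt]; omega) θ
    push_cast at h
    rw [h, mul_zero]
  · intro h; exact absurd hi h

/-- Triangular coefficients. -/
noncomputable def tent (M : ℕ) (j : ℕ) : ℝ := min (j : ℝ) (M - j)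

lemma tent_nonneg {M j : ℕ} (h : j < M) : 0 ≤ tent M j := by
  have : (j : ℝ) < M := by exact_mod_cast h
  exact le_min (by positivity) (by linarith)

lemma sum_sq_tent_sub (M : ℕ) :
    ∑ j ∈ Finset.range M, (tent M (j + 1) - tent M j) ^ 2 ≤ M := by
  calc _ ≤ ∑ j ∈ Finset.range M, (1 : ℝ) := by
        refine Finset.sum_le_sum fun j _ ↦ ?_
        rw [sq_le_one_iff_abs_le_one, abs_le]
        simp only [tent]
        push_cast
        constructor <;> rcases min_cases (j : ℝ) (M - j) with h | h <;>
          rcases min_cases ((j : ℝ) + 1) (M - (j + 1)) with h' | h' <;> linarith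
    _ = M := by simp

/-- The middle half of the indices already has `tent ≥ q`. -/
lemma le_sum_sq_tent (q : ℕ) :
    2 * (q : ℝ) ^ 3 ≤ ∑ j ∈ Finset.range (4 * q), tent (4 * q) j ^ 2 := by
  calc 2 * (q : ℝ) ^ 3 = ∑ j ∈ Finset.Ico q (3 * q), (q : ℝ) ^ 2 := by
        have : 3 * q - q = 2 * q := by omega
        simp [this]; ring
    _ ≤ ∑ j ∈ Finset.Ico q (3 * q), tent (4 * q) j ^ 2 := by
        refine Finset.sum_le_sum fun j hj ↦ ?_
        rw [Finset.mem_Ico] at hj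
        have h1 : (q : ℝ) ≤ j := by exact_mod_cast hj.1
        have h2 : (j : ℝ) < 3 * q := by exact_mod_cast hj.2
        refine pow_le_pow_left₀ (by positivity) (le_min h1 ?_) 2
        push_cast
        linarith
    _ ≤ _ := by
        refine Finset.sum_le_sum_of_subset_of_nonneg (fun j hj ↦ ?_) fun _ _ _ ↦ by positivity
        rw [Finset.mem_Ico] at hj
        rw [Finset.mem_range]; omega

/-- The node `cos (2 π s / (4 q))`. -/
noncomputable def node (q s : ℕ) : ℝ := Real.cos (2 * Real.pi * s / (4 * q : ℕ))

/-- The polynomial weight attached to the node `s`. -/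
noncomputable def weight (q s : ℕ) (x : ℝ) : ℝ :=
  ∑ i ∈ Finset.range (4 * q), ∑ j ∈ Finset.range (4 * q),
    (tent (4 * q) i * tent (4 * q) j * Real.cos (((i : ℝ) - j) * (2 * Real.pi * s / (4 * q : ℕ))) /
      ((4 * q : ℕ) * ∑ j ∈ Finset.range (4 * q), tent (4 * q) j ^ 2)) *
        (Polynomial.Chebyshev.T ℝ ((i : ℤ) - j)).eval x

/-- `T_n (cos θ) = cos (n θ)`, and `cos (n φ) cos (n θ)` averages the kernel over `θ` and `-θ`.
Hence the weight inherits positivity and the grid identities while being a polynomial in `cos θ`. -/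
lemma weight_cos (q s : ℕ) (θ : ℝ) :
    weight q s (Real.cos θ) =
      (trigKernel (tent (4 * q)) (4 * q) (θ - 2 * Real.pi * s / (4 * q : ℕ)) +
        trigKernel (tent (4 * q)) (4 * q) (-θ - 2 * Real.pi * s / (4 * q : ℕ))) /
        (2 * ((4 * q : ℕ) * ∑ j ∈ Finset.range (4 * q), tent (4 * q) j ^ 2)) := by
  simp only [weight, trigKernel]
  rw [← Finset.sum_add_distrib, Finset.sum_div]
  refine Finset.sum_congr rfl fun i _ ↦ ?_
  rw [← Finset.sum_add_distrib, Finset.sum_div]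
  refine Finset.sum_congr rfl fun j _ ↦ ?_
  rw [Polynomial.Chebyshev.T_real_cos]
  push_cast
  rw [mul_sub, mul_sub, mul_neg, Real.cos_sub, Real.cos_sub, Real.cos_neg, Real.sin_neg]
  generalize (4 * (q : ℝ) * ∑ j ∈ Finset.range (4 * q), tent (4 * q) j ^ 2) = Z
  ring

lemma weight_nonneg (q s : ℕ) {x : ℝ} (hx : |x| ≤ 1) : 0 ≤ weight q s x := by
  rw [abs_le] at hx
  rw [← Real.cos_arccos hx.1 hx.2, weight_cos]
  have := trigKernel_nonneg (tent (4 * q)) (4 * q)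
  exact div_nonneg (add_nonneg (this _) (this _)) (by positivity)

lemma sum_sq_tent_pos {q : ℕ} (hq : 0 < q) :
    0 < ∑ j ∈ Finset.range (4 * q), tent (4 * q) j ^ 2 :=
  lt_of_lt_of_le (by positivity) (le_sum_sq_tent q)

lemma sum_weight {q : ℕ} (hq : 0 < q) {x : ℝ} (hx : |x| ≤ 1) :
    ∑ s ∈ Finset.range (4 * q), weight q s x = 1 := by
  rw [abs_le] at hx
  rw [← Real.cos_arccos hx.1 hx.2]
  simp only [weight_cos]
  rw [← Finset.sum_div, Finset.sum_add_distrib, sum_trigKernel_grid, sum_trigKernel_grid]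
  have := sum_sq_tent_pos hq
  have h4 : (0 : ℝ) < (4 * q : ℕ) := by positivity
  field_simp
  ring

lemma sq_cos_sub_cos_le (θ φ : ℝ) :
    (Real.cos θ - Real.cos φ) ^ 2 ≤ 2 - 2 * Real.cos (θ - φ) := by
  rw [Real.cos_sub]
  nlinarith [sq_nonneg (Real.sin θ - Real.sin φ), Real.sin_sq_add_cos_sq θ,
    Real.sin_sq_add_cos_sq φ]

/-- The squared distance is at most `2 - 2 cos` of the angle difference, so the second moment is the
ratio of `∑ (a_{j+1} - a_j) ^ 2` to `∑ a_j ^ 2`. Triangular coefficients make it of order `q⁻²`. -/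
lemma sum_weight_mul_sq_sub_le {q : ℕ} (hq : 0 < q) {x : ℝ} (hx : |x| ≤ 1) :
    ∑ s ∈ Finset.range (4 * q), weight q s x * (x - node q s) ^ 2 ≤ 2 / (q : ℝ) ^ 2 := by
  rw [abs_le] at hx
  rw [← Real.cos_arccos hx.1 hx.2]
  set θ := Real.arccos x
  have hS := sum_sq_tent_pos hq
  have h4 : (0 : ℝ) < (4 * q : ℕ) := by positivity
  have hq' : (0 : ℝ) < q := by positivity
  set S := ∑ j ∈ Finset.range (4 * q), tent (4 * q) j ^ 2 with hSdef
  set b : ℕ → ℝ := fun j ↦ tent (4 * q) (j + 1) - tent (4 * q) j with hb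
  have hdiff (t : ℝ) := trigKernel_mul_two_sub (tent (4 * q)) (4 * q) (by simp [tent])
    (by simp [tent]) t
  calc _ ≤ ∑ s ∈ Finset.range (4 * q),
        (trigKernel b (4 * q) (θ - 2 * Real.pi * s / (4 * q : ℕ)) +
          trigKernel b (4 * q) (-θ - 2 * Real.pi * s / (4 * q : ℕ))) / (2 * ((4 * q : ℕ) * S)) := by
        refine Finset.sum_le_sum fun s _ ↦ ?_
        rw [weight_cos, node, div_mul_eq_mul_div, add_mul, hb, ← hdiff, ← hdiff]
        refine div_le_div_of_nonneg_right (add_le_add ?_ ?_) (by positivity)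
        · exact mul_le_mul_of_nonneg_left (sq_cos_sub_cos_le _ _) (trigKernel_nonneg _ _ _)
        · rw [← Real.cos_neg θ]
          exact mul_le_mul_of_nonneg_left (sq_cos_sub_cos_le _ _) (trigKernel_nonneg _ _ _)
    _ = (∑ j ∈ Finset.range (4 * q), b j ^ 2) / S := by
        rw [← Finset.sum_div, Finset.sum_add_distrib, sum_trigKernel_grid, sum_trigKernel_grid]
        field_simp
        ring
    _ ≤ (4 * q : ℕ) / (2 * (q : ℝ) ^ 3) :=
        div_le_div₀ h4.le (sum_sq_tent_sub _) (by positivity) (le_sum_sq_tent q)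
    _ = 2 / (q : ℝ) ^ 2 := by
        push_cast
        field_simp
        ring

/-! ### Calculus of coefficient norms. -/

/-- `g` is a polynomial function of degree at most `ℓ` whose coefficients have `ℓ¹` norm at most
`B`. -/
def HasCoeffBound {n : ℕ} (g : (Fin n → ℝ) → ℝ) (ℓ : ℕ) (B : ℝ) : Prop :=
  ∃ (ι : Type) (_ : Fintype ι) (c : ι → ℝ) (a : ι → Fin n → ℕ),
    (∀ t, ∑ i, a t i ≤ ℓ) ∧ ∑ t, |c t| ≤ B ∧ ∀ x, g x = ∑ t, c t * ∏ i, x i ^ a t i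

namespace HasCoeffBound

variable {n : ℕ} {g h : (Fin n → ℝ) → ℝ} {ℓ ℓ' : ℕ} {B B' : ℝ}

lemma mono (hg : HasCoeffBound g ℓ B) (hℓ : ℓ ≤ ℓ') (hB : B ≤ B') : HasCoeffBound g ℓ' B' := by
  obtain ⟨ι, _, c, a, h1, h2, h3⟩ := hg
  exact ⟨ι, _, c, a, fun t ↦ (h1 t).trans hℓ, h2.trans hB, h3⟩

lemma nonneg (hg : HasCoeffBound g ℓ B) : 0 ≤ B := by
  obtain ⟨ι, _, c, a, h1, h2, h3⟩ := hg
  exact (Finset.sum_nonneg fun _ _ ↦ abs_nonneg _).trans h2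

lemma const (b : ℝ) : HasCoeffBound (fun _ : Fin n → ℝ ↦ b) 0 |b| :=
  ⟨Unit, inferInstance, fun _ ↦ b, fun _ _ ↦ 0, by simp, by simp, by simp⟩

lemma coord (i : Fin n) : HasCoeffBound (fun x : Fin n → ℝ ↦ x i) 1 1 := by
  refine ⟨Unit, inferInstance, fun _ ↦ 1, fun _ ↦ Pi.single i 1, ?_, by simp, fun x ↦ ?_⟩
  · intro t
    simp [Finset.sum_pi_single']
  · rw [Fintype.sum_unique, one_mul, Finset.prod_eq_single i]
    · simp
    · intro j _ hj; simp [hj]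
    · simp

lemma add (hg : HasCoeffBound g ℓ B) (hh : HasCoeffBound h ℓ B') :
    HasCoeffBound (fun x ↦ g x + h x) ℓ (B + B') := by
  obtain ⟨ι, _, c, a, h1, h2, h3⟩ := hg
  obtain ⟨κ, _, c', a', h1', h2', h3'⟩ := hh
  refine ⟨ι ⊕ κ, inferInstance, Sum.elim c c', Sum.elim a a', ?_, ?_, fun x ↦ ?_⟩
  · rintro (t | t)
    · exact h1 t
    · exact h1' t
  · simpa using add_le_add h2 h2'
  · simp [h3, h3']

lemma mul (hg : HasCoeffBound g ℓ B) (hh : HasCoeffBound h ℓ' B') :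
    HasCoeffBound (fun x ↦ g x * h x) (ℓ + ℓ') (B * B') := by
  have hB := hg.nonneg
  obtain ⟨ι, _, c, a, h1, h2, h3⟩ := hg
  obtain ⟨κ, _, c', a', h1', h2', h3'⟩ := hh
  refine ⟨ι × κ, inferInstance, fun t ↦ c t.1 * c' t.2, fun t i ↦ a t.1 i + a' t.2 i, ?_, ?_,
    fun x ↦ ?_⟩
  · rintro ⟨t, t'⟩
    rw [Finset.sum_add_distrib]
    exact add_le_add (h1 t) (h1' t')
  · simp only [abs_mul]
    rw [Fintype.sum_prod_type' (fun t t' ↦ |c t| * |c' t'|), ← Fintype.sum_mul_sum]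
    exact mul_le_mul h2 h2' (Finset.sum_nonneg fun _ _ ↦ abs_nonneg _) hB
  · simp only [h3, h3']
    rw [Fintype.sum_mul_sum, ← Fintype.sum_prod_type']
    refine Finset.sum_congr rfl fun t _ ↦ ?_
    simp only [pow_add, Finset.prod_mul_distrib]
    ring

lemma const_mul (hg : HasCoeffBound g ℓ B) (b : ℝ) :
    HasCoeffBound (fun x ↦ b * g x) ℓ (|b| * B) := by
  simpa using (const b).mul hg

lemma sum {ι : Type*} (s : Finset ι) {g : ι → (Fin n → ℝ) → ℝ} {B : ι → ℝ}
    (hg : ∀ t ∈ s, HasCoeffBound (g t) ℓ (B t)) :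
    HasCoeffBound (fun x ↦ ∑ t ∈ s, g t x) ℓ (∑ t ∈ s, B t) := by
  classical
  induction s using Finset.induction_on with
  | empty => simpa using (const (n := n) 0).mono (Nat.zero_le ℓ) le_rfl
  | insert t s hts ih =>
    simp only [Finset.sum_insert hts]
    exact (hg t (Finset.mem_insert_self _ _)).add
      (ih fun u hu ↦ hg u (Finset.mem_insert_of_mem hu))

lemma prod {ι : Type*} (s : Finset ι) {g : ι → (Fin n → ℝ) → ℝ} {ℓ : ι → ℕ} {B : ι → ℝ}
    (hg : ∀ t ∈ s, HasCoeffBound (g t) (ℓ t) (B t)) :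
    HasCoeffBound (fun x ↦ ∏ t ∈ s, g t x) (∑ t ∈ s, ℓ t) (∏ t ∈ s, B t) := by
  classical
  induction s using Finset.induction_on with
  | empty => simpa using const (n := n) 1
  | insert t s hts ih =>
    simp only [Finset.prod_insert hts, Finset.sum_insert hts]
    exact (hg t (Finset.mem_insert_self _ _)).mul
      (ih fun u hu ↦ hg u (Finset.mem_insert_of_mem hu))

lemma pow (hg : HasCoeffBound g ℓ B) (m : ℕ) :
    HasCoeffBound (fun x ↦ g x ^ m) (m * ℓ) (B ^ m) := by
  simpa using prod (Finset.range m) (fun _ _ ↦ hg)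

lemma comp {d : ℕ} (hg : HasCoeffBound g ℓ B) {u : Fin n → (Fin d → ℝ) → ℝ} {H : ℝ} (hH : 1 ≤ H)
    (hu : ∀ i, HasCoeffBound (u i) 1 H) :
    HasCoeffBound (fun x ↦ g (fun i ↦ u i x)) ℓ (B * H ^ ℓ) := by
  obtain ⟨ι, _, c, a, h1, h2, h3⟩ := hg
  simp only [h3]
  refine (sum (ℓ := ℓ) (B := fun t ↦ |c t| * H ^ ℓ) Finset.univ fun t _ ↦ ?_).mono le_rfl ?_
  · refine HasCoeffBound.const_mul ?_ _
    refine (prod Finset.univ fun i _ ↦ (hu i).pow (a t i)).mono ?_ ?_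
    · simpa using h1 t
    · rw [Finset.prod_pow_eq_pow_sum]
      exact pow_le_pow_right₀ hH (h1 t)
  · rw [← Finset.sum_mul]
    exact mul_le_mul_of_nonneg_right h2 (by positivity)

lemma abs_le (hg : HasCoeffBound g ℓ B) {x : Fin n → ℝ} {H : ℝ} (hH : 1 ≤ H)
    (hx : ∀ i, |x i| ≤ H) : |g x| ≤ B * H ^ ℓ := by
  obtain ⟨ι, _, c, a, h1, h2, h3⟩ := hg
  rw [h3]
  refine (Finset.abs_sum_le_sum_abs _ _).trans ?_
  calc ∑ t, |c t * ∏ i, x i ^ a t i| ≤ ∑ t, |c t| * H ^ ℓ := by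
        refine Finset.sum_le_sum fun t _ ↦ ?_
        rw [abs_mul, Finset.abs_prod]
        refine mul_le_mul_of_nonneg_left ?_ (abs_nonneg _)
        calc ∏ i, |x i ^ a t i| ≤ ∏ i, H ^ a t i := by
              refine Finset.prod_le_prod (fun _ _ ↦ abs_nonneg _) fun i _ ↦ ?_
              rw [abs_pow]
              exact pow_le_pow_left₀ (abs_nonneg _) (hx i) _
          _ = H ^ ∑ i, a t i := Finset.prod_pow_eq_pow_sum _ _ _
          _ ≤ H ^ ℓ := pow_le_pow_right₀ hH (h1 t)
    _ ≤ B * H ^ ℓ := by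
        rw [← Finset.sum_mul]
        exact mul_le_mul_of_nonneg_right h2 (by positivity)

/-- The recursion `T_{m+2} = 2 x T_{m+1} - T_m` costs `2 · 3 + 1 ≤ 9` over two steps. -/
lemma chebyshev_nat (hg : HasCoeffBound g 1 1) (m : ℕ) :
    HasCoeffBound (fun x ↦ (Polynomial.Chebyshev.T ℝ m).eval (g x)) m (3 ^ m) := by
  induction m using Nat.twoStepInduction with
  | zero => simpa using const (n := n) 1
  | one => simpa using hg.mono le_rfl (by norm_num)
  | more m ih1 ih2 =>
    have h := (((hg.const_mul 2).mul ih2).mono (by omega : _ ≤ m + 2) le_rfl).add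
      ((ih1.const_mul (-1)).mono (by omega : _ ≤ m + 2) le_rfl)
    push_cast
    simp only [Polynomial.Chebyshev.T_add_two, Polynomial.eval_sub, Polynomial.eval_mul,
      Polynomial.eval_X, Polynomial.eval_ofNat]
    push_cast at h
    convert h.mono le_rfl (?_ : _ ≤ (3 : ℝ) ^ (m + 2)) using 2
    · ring
    · have : (0 : ℝ) < 3 ^ m := by positivity
      norm_num [pow_succ]
      linarith

lemma chebyshev (hg : HasCoeffBound g 1 1) (m : ℤ) :
    HasCoeffBound (fun x ↦ (Polynomial.Chebyshev.T ℝ m).eval (g x)) m.natAbs (3 ^ m.natAbs) := by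
  rw [← Polynomial.Chebyshev.T_natAbs]
  exact hg.chebyshev_nat _

lemma weight {q : ℕ} (hq : 0 < q) (hg : HasCoeffBound g 1 1) (s : ℕ) :
    HasCoeffBound (fun x ↦ weight q s (g x)) (4 * q) (3 ^ (4 * q)) := by
  have hS := sum_sq_tent_pos hq
  have h4 : (0 : ℝ) < (4 * q : ℕ) := by positivity
  set S := ∑ j ∈ Finset.range (4 * q), tent (4 * q) j ^ 2 with hSdef
  have key := sum (n := n) (ℓ := 4 * q) (Finset.range (4 * q)) fun i hi ↦
    sum (ℓ := 4 * q) (Finset.range (4 * q)) fun j hj ↦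
      ((((hg.chebyshev ((i : ℤ) - j)).const_mul
        (tent (4 * q) i * tent (4 * q) j *
          Real.cos (((i : ℝ) - j) * (2 * Real.pi * s / (4 * q : ℕ))) / ((4 * q : ℕ) * S)))).mono
        (by rw [Finset.mem_range] at hi hj; omega)
        (?_ : _ ≤ tent (4 * q) i * tent (4 * q) j * (3 ^ (4 * q) / ((4 * q : ℕ) * S))))
  · refine key.mono le_rfl ?_
    simp only [← Finset.sum_mul, ← Finset.mul_sum]
    -- Cauchy–Schwarz: the normalising denominator absorbs the whole double sum of tent
    -- coefficients, leaving only the Chebyshev bound.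
    have hcs : (∑ j ∈ Finset.range (4 * q), tent (4 * q) j) ^ 2 ≤ (4 * q : ℕ) * S := by
      simpa using sq_sum_le_card_mul_sum_sq (s := Finset.range (4 * q)) (f := tent (4 * q))
    rw [← sq, mul_div_assoc', div_le_iff₀ (by positivity), mul_comm]
    exact mul_le_mul_of_nonneg_left hcs (by positivity)
  · rw [abs_div, abs_mul, abs_mul, abs_of_pos (by positivity : 0 < ((4 * q : ℕ) : ℝ) * S)]
    rw [Finset.mem_range] at hi hj
    have hi0 := tent_nonneg hi
    have hj0 := tent_nonneg hj
    rw [abs_of_nonneg hi0, abs_of_nonneg hj0, div_mul_eq_mul_div,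
      ← mul_div_assoc (_ * _) ((3 : ℝ) ^ (4 * q))]
    refine div_le_div_of_nonneg_right ?_ (by positivity)
    refine mul_le_mul (mul_le_of_le_one_right (mul_nonneg hi0 hj0) (Real.abs_cos_le_one _))
      (pow_le_pow_right₀ (by norm_num) (by omega)) (by positivity) (mul_nonneg hi0 hj0)

end HasCoeffBound

/-! ### Approximation of Lipschitz functions on the cube. -/

/-- The tensor product of the kernels, applied to `G`. -/
noncomputable def jackson {k : ℕ} (q : ℕ) (G : (Fin k → ℝ) → ℝ) (u : Fin k → ℝ) : ℝ :=
  ∑ s ∈ Fintype.piFinset fun _ : Fin k ↦ Finset.range (4 * q),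
    G (fun i ↦ node q (s i)) * ∏ i, weight q (s i) (u i)

lemma hasCoeffBound_jackson {k q : ℕ} (hq : 0 < q) {G : (Fin k → ℝ) → ℝ} (hG : ∀ u, |G u| ≤ 1) :
    HasCoeffBound (jackson q G) (4 * (k * q)) (5 ^ (4 * (k * q))) := by
  have h := HasCoeffBound.sum (ℓ := 4 * (k * q))
    (Fintype.piFinset fun _ : Fin k ↦ Finset.range (4 * q)) fun s _ ↦
      ((HasCoeffBound.prod Finset.univ fun i _ ↦
        (HasCoeffBound.coord i).weight hq (s i)).const_mul (G fun i ↦ node q (s i))).mono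
        (by simp; exact le_of_eq (by ring))
        (mul_le_of_le_one_left (by positivity) (hG _))
  refine h.mono le_rfl ?_
  simp only [Finset.prod_const, Finset.sum_const, Fintype.card_piFinset, Finset.card_range,
    Finset.card_univ, Fintype.card_fin, nsmul_eq_mul]
  push_cast
  -- The `(4q) ^ k` nodes are absorbed by enlarging the base: `4 · 3 ^ 4 = 324 ≤ 625 = 5 ^ 4`.
  have h4 : 4 * (q : ℝ) ≤ 4 ^ q := by
    have : 4 * q ≤ 4 ^ q := by
      obtain ⟨p, rfl⟩ := Nat.exists_eq_succ_of_ne_zero hq.ne'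
      have := Nat.lt_pow_self (n := p) (a := 4) (by norm_num)
      rw [Nat.succ_eq_add_one, pow_succ]
      omega
    exact_mod_cast this
  calc (4 * (q : ℝ)) ^ k * (3 ^ (4 * q)) ^ k = (4 * (q : ℝ) * 81 ^ q) ^ k := by
        rw [mul_pow _ (81 ^ q) k, pow_mul 3 4 q]; norm_num
    _ ≤ (4 ^ q * 81 ^ q) ^ k := by gcongr
    _ = (324 ^ q) ^ k := by rw [← mul_pow]; norm_num
    _ ≤ (625 ^ q) ^ k := by gcongr; norm_num
    _ = 5 ^ (4 * (k * q)) := by rw [pow_mul 5 4, ← pow_mul, mul_comm q k]; norm_num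

lemma prod_weight_nonneg {k : ℕ} (q : ℕ) {u : Fin k → ℝ} (hu : ∀ i, |u i| ≤ 1) (s : Fin k → ℕ) :
    0 ≤ ∏ i, weight q (s i) (u i) := Finset.prod_nonneg fun i _ ↦ weight_nonneg _ _ (hu i)

lemma sum_prod_weight {k q : ℕ} (hq : 0 < q) {u : Fin k → ℝ} (hu : ∀ i, |u i| ≤ 1) :
    ∑ s ∈ Fintype.piFinset fun _ : Fin k ↦ Finset.range (4 * q), ∏ i, weight q (s i) (u i) = 1 := by
  rw [← Finset.prod_univ_sum (fun _ : Fin k ↦ Finset.range (4 * q)) fun i s ↦ weight q s (u i)]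
  exact Finset.prod_eq_one fun i _ ↦ sum_weight hq (hu i)

lemma sum_prod_weight_mul_sq_le {k q : ℕ} (hq : 0 < q) {u : Fin k → ℝ} (hu : ∀ i, |u i| ≤ 1)
    (j : Fin k) :
    ∑ s ∈ Fintype.piFinset fun _ : Fin k ↦ Finset.range (4 * q),
      (∏ i, weight q (s i) (u i)) * (u j - node q (s j)) ^ 2 ≤ 2 / (q : ℝ) ^ 2 := by
  have h := Finset.prod_univ_sum (fun _ : Fin k ↦ Finset.range (4 * q)) fun i s ↦
    weight q s (u i) * (if i = j then (u i - node q s) ^ 2 else 1)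
  have e (s : Fin k → ℕ) : ∏ i, (weight q (s i) (u i) *
      (if i = j then (u i - node q (s i)) ^ 2 else 1)) =
      (∏ i, weight q (s i) (u i)) * (u j - node q (s j)) ^ 2 := by
    rw [Finset.prod_mul_distrib, Finset.prod_ite_eq' Finset.univ j]
    simp
  simp only [e] at h
  rw [← h, ← Finset.mul_prod_erase _ _ (Finset.mem_univ j), Finset.prod_eq_one, mul_one]
  · simpa using sum_weight_mul_sq_sub_le hq (hu j)
  · intro i hi
    simpa [Finset.ne_of_mem_erase hi] using sum_weight hq (hu i)

/-- On the cube the weights form a product probability distribution on the nodes. The error is at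
most `L` times the mean distance from `u`, hence at most `L` times the root of the second moment,
which adds up over coordinates. -/
lemma abs_jackson_sub_le {k q : ℕ} (hq : 0 < q) {G : (Fin k → ℝ) → ℝ} {L : ℝ} (hL : 0 ≤ L)
    (hG : ∀ u v, |G u - G v| ≤ L * √(∑ i, (u i - v i) ^ 2)) {u : Fin k → ℝ}
    (hu : ∀ i, |u i| ≤ 1) : |jackson q G u - G u| ≤ L * (√(2 * k) / q) := by
  set I := Fintype.piFinset fun _ : Fin k ↦ Finset.range (4 * q) with hI
  set p : (Fin k → ℕ) → ℝ := fun s ↦ ∏ i, weight q (s i) (u i) with hp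
  set D : (Fin k → ℕ) → ℝ := fun s ↦ ∑ i, (u i - node q (s i)) ^ 2 with hD
  have hp0 (s) : 0 ≤ p s := prod_weight_nonneg q hu s
  have hp1 : ∑ s ∈ I, p s = 1 := sum_prod_weight hq hu
  have hD0 (s) : 0 ≤ D s := Finset.sum_nonneg fun _ _ ↦ sq_nonneg _
  have hpD : ∑ s ∈ I, p s * D s ≤ k * (2 / (q : ℝ) ^ 2) := by
    simp only [hD, Finset.mul_sum]
    rw [Finset.sum_comm]
    refine (Finset.sum_le_sum fun j _ ↦ sum_prod_weight_mul_sq_le hq hu j).trans ?_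
    simp
  have hsqrt : ∑ s ∈ I, p s * √(D s) ≤ √(2 * k) / q := by
    have hcs := Real.sum_sqrt_mul_sqrt_le I hp0 (fun s ↦ mul_nonneg (hp0 s) (hD0 s))
    have e (s) : √(p s) * √(p s * D s) = p s * √(D s) := by
      rw [Real.sqrt_mul (hp0 s), ← mul_assoc, Real.mul_self_sqrt (hp0 s)]
    simp only [e, hp1, Real.sqrt_one, one_mul] at hcs
    refine hcs.trans ((Real.sqrt_le_sqrt hpD).trans (le_of_eq ?_))
    rw [show (k : ℝ) * (2 / (q : ℝ) ^ 2) = 2 * k / (q : ℝ) ^ 2 by ring,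
      Real.sqrt_div' _ (by positivity), Real.sqrt_sq (by positivity)]
  have e : jackson q G u - G u = ∑ s ∈ I, p s * (G (fun i ↦ node q (s i)) - G u) := by
    simp only [mul_sub, Finset.sum_sub_distrib, ← Finset.sum_mul, hp1, one_mul, jackson]
    simp only [hp, mul_comm, hI]
  rw [e]
  calc _ ≤ ∑ s ∈ I, |p s * (G (fun i ↦ node q (s i)) - G u)| := Finset.abs_sum_le_sum_abs _ _
    _ ≤ ∑ s ∈ I, L * (p s * √(D s)) := by
        refine Finset.sum_le_sum fun s _ ↦ ?_
        rw [abs_mul, abs_of_nonneg (hp0 s), abs_sub_comm, mul_left_comm]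
        exact mul_le_mul_of_nonneg_left (hG _ _) (hp0 s)
    _ ≤ _ := by
        rw [← Finset.mul_sum]
        exact mul_le_mul_of_nonneg_left hsqrt hL

/-! ### The Lipschitz majorant. -/

/-- The sup-convolution `sup_z (F z - c * ‖y - z‖)`. -/
noncomputable def supConv {k : ℕ} (F : EuclideanSpace ℝ (Fin k) → ℝ) (c : ℝ)
    (y : EuclideanSpace ℝ (Fin k)) : ℝ :=
  ⨆ z, F z - c * ‖y - z‖

section supConv

variable {k : ℕ} {F : EuclideanSpace ℝ (Fin k) → ℝ} {c : ℝ}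

lemma bddAbove_supConv (hF : ∀ y, F y = -1 ∨ F y = 1) (hc : 0 ≤ c)
    (y : EuclideanSpace ℝ (Fin k)) : BddAbove (Set.range fun z ↦ F z - c * ‖y - z‖) := by
  refine ⟨1, ?_⟩
  rintro _ ⟨z, rfl⟩
  have : 0 ≤ c * ‖y - z‖ := by positivity
  rcases hF z with h | h <;> simp only [h] <;> linarith

lemma le_supConv (hF : ∀ y, F y = -1 ∨ F y = 1) (hc : 0 ≤ c) (y : EuclideanSpace ℝ (Fin k)) :
    F y ≤ supConv F c y :=
  le_trans (by simp) (le_ciSup (bddAbove_supConv hF hc y) y)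

lemma supConv_le_one (hF : ∀ y, F y = -1 ∨ F y = 1) (hc : 0 ≤ c)
    (y : EuclideanSpace ℝ (Fin k)) : supConv F c y ≤ 1 := by
  refine ciSup_le fun z ↦ ?_
  have : 0 ≤ c * ‖y - z‖ := by positivity
  rcases hF z with h | h <;> simp only [h] <;> linarith

lemma abs_supConv_le_one (hF : ∀ y, F y = -1 ∨ F y = 1) (hc : 0 ≤ c)
    (y : EuclideanSpace ℝ (Fin k)) : |supConv F c y| ≤ 1 := by
  refine abs_le.mpr ⟨le_trans ?_ (le_supConv hF hc y), supConv_le_one hF hc y⟩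
  rcases hF y with h | h <;> rw [h]; norm_num

lemma supConv_sub_le (hF : ∀ y, F y = -1 ∨ F y = 1) (hc : 0 ≤ c)
    (x y : EuclideanSpace ℝ (Fin k)) : supConv F c x - supConv F c y ≤ c * ‖x - y‖ := by
  rw [sub_le_iff_le_add]
  refine ciSup_le fun z ↦ ?_
  have h1 := le_ciSup (bddAbove_supConv hF hc y) z
  have h2 : c * ‖y - z‖ ≤ c * ‖x - y‖ + c * ‖x - z‖ := by
    rw [← mul_add]
    refine mul_le_mul_of_nonneg_left ?_ hc
    rw [norm_sub_rev x y]
    exact norm_sub_le_norm_sub_add_norm_sub y x z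
  have h3 : F z - c * ‖y - z‖ ≤ supConv F c y := h1
  linarith

lemma abs_supConv_sub_le (hF : ∀ y, F y = -1 ∨ F y = 1) (hc : 0 ≤ c)
    (x y : EuclideanSpace ℝ (Fin k)) : |supConv F c x - supConv F c y| ≤ c * ‖x - y‖ := by
  refine abs_le.mpr ⟨?_, supConv_sub_le hF hc x y⟩
  have := supConv_sub_le hF hc y x
  rw [norm_sub_rev] at this
  linarith

lemma continuous_supConv (hF : ∀ y, F y = -1 ∨ F y = 1) (hc : 0 ≤ c) :
    Continuous (supConv F c) := by
  refine (LipschitzWith.of_dist_le_mul (K := ⟨c, hc⟩) fun x y ↦ ?_).continuous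
  rw [dist_eq_norm, dist_eq_norm, Real.norm_eq_abs]
  exact abs_supConv_sub_le hF hc x y

/-- With slope `2 / ρ` the penalty beyond distance `ρ` is at least `2`, the full oscillation of `F`,
so farther points contribute at most `-1`. -/
lemma supConv_le_of_forall_le {ρ : ℝ} (hρ : 0 < ρ) (hF : ∀ y, F y = -1 ∨ F y = 1)
    (y : EuclideanSpace ℝ (Fin k)) {b : ℝ} (hb : -1 ≤ b) (h : ∀ z, ‖z‖ ≤ ρ → F (y + z) ≤ b) :
    supConv F (2 / ρ) y ≤ b := by
  refine ciSup_le fun z ↦ ?_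
  rcases le_total ‖y - z‖ ρ with hz | hz
  · have h1 := h (z - y) (by rwa [norm_sub_rev])
    rw [add_sub_cancel] at h1
    have : 0 ≤ 2 / ρ * ‖y - z‖ := by positivity
    linarith
  · have h1 : 2 ≤ 2 / ρ * ‖y - z‖ := by
      rw [div_mul_eq_mul_div, le_div_iff₀ hρ]
      linarith
    rcases hF z with h2 | h2 <;> rw [h2] <;> linarith

end supConv

/-! ### Concepts, projections and the cost of the majorant. -/

section Concept

variable {d : ℕ} {f : EuclideanSpace ℝ (Fin d) → ℝ}

lemma IsConcept.neg (hf : IsConcept f) : IsConcept (fun x ↦ -f x) :=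
  ⟨fun x ↦ by rcases hf.range x with h | h <;> simp [h], hf.measurable.neg⟩

lemma IsConcept.bddAbove (hf : IsConcept f) (ρ : ℝ) (x : EuclideanSpace ℝ (Fin d)) :
    BddAbove (Set.range fun z : {z : EuclideanSpace ℝ (Fin d) // ‖z‖ ≤ ρ} ↦ f (x + z)) :=
  ⟨1, by rintro _ ⟨z, rfl⟩; rcases hf.range (x + z) with h | h <;> simp [h]⟩

lemma IsConcept.le_dilation (hf : IsConcept f) {ρ : ℝ} (x : EuclideanSpace ℝ (Fin d))
    {z : EuclideanSpace ℝ (Fin d)} (hz : ‖z‖ ≤ ρ) : f (x + z) ≤ dilation f ρ x :=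
  le_ciSup (hf.bddAbove ρ x) ⟨z, hz⟩

lemma dilation_neg (f : EuclideanSpace ℝ (Fin d) → ℝ) (ρ : ℝ) (x : EuclideanSpace ℝ (Fin d)) :
    dilation (fun x ↦ -f x) ρ x = -erosion f ρ x := by
  rw [dilation, erosion, iInf, Real.sInf_def, neg_neg, iSup, ← Set.image_neg_eq_neg,
    ← Set.range_comp]
  rfl

lemma erosion_neg (f : EuclideanSpace ℝ (Fin d) → ℝ) (ρ : ℝ) (x : EuclideanSpace ℝ (Fin d)) :
    erosion (fun x ↦ -f x) ρ x = -dilation f ρ x := by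
  have := dilation_neg (fun x ↦ -f x) ρ x
  simp only [neg_neg] at this
  rw [this, neg_neg]

lemma IsConcept.erosion_le (hf : IsConcept f) {ρ : ℝ} (hρ : 0 ≤ ρ)
    (x : EuclideanSpace ℝ (Fin d)) : erosion f ρ x ≤ f x := by
  have h := hf.neg.le_dilation x (z := 0) (ρ := ρ) (by simpa using hρ)
  rw [dilation_neg, add_zero] at h
  linarith

lemma HasSmoothBoundary.neg {σ : ℝ} {D : Measure (EuclideanSpace ℝ (Fin d))}
    (h : HasSmoothBoundary f σ D) : HasSmoothBoundary (fun x ↦ -f x) σ D := by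
  intro ρ hρ
  have := h ρ hρ
  simpa only [dilation_neg, erosion_neg, sub_neg_eq_add, neg_add_eq_sub] using this

lemma IsConcept.integrable (hf : IsConcept f) (D : Measure (EuclideanSpace ℝ (Fin d)))
    [IsFiniteMeasure D] : Integrable f D :=
  Integrable.of_bound hf.measurable.aestronglyMeasurable 1
    (.of_forall fun x ↦ by rcases hf.range x with h | h <;> simp [h])

end Concept

section Projection

variable {k d : ℕ} {W : Matrix (Fin k) (Fin d) ℝ}

lemma norm_transpose_mulVec (hW : W * W.transpose = 1) (z : EuclideanSpace ℝ (Fin k)) :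
    ‖WithLp.toLp 2 (W.transpose.mulVec z.ofLp)‖ = ‖z‖ := by
  have h : W.transpose.mulVec z.ofLp ⬝ᵥ W.transpose.mulVec z.ofLp = z.ofLp ⬝ᵥ z.ofLp := by
    rw [Matrix.dotProduct_mulVec, Matrix.vecMul_transpose, Matrix.mulVec_mulVec, hW,
      Matrix.one_mulVec]
  rw [EuclideanSpace.norm_eq, EuclideanSpace.norm_eq]
  congr 1
  simpa [dotProduct, sq] using h

lemma norm_toLp_row (hW : W * W.transpose = 1) (i : Fin k) : ‖WithLp.toLp 2 (W i)‖ = 1 := by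
  have h := congrFun (congrFun hW i) i
  rw [Matrix.mul_apply, Matrix.one_apply_eq] at h
  rw [EuclideanSpace.norm_eq, Real.sqrt_eq_one]
  simpa [sq] using h

lemma abs_entry_le_one (hW : W * W.transpose = 1) (i : Fin k) (j : Fin d) : |W i j| ≤ 1 := by
  have h := PiLp.norm_apply_le (WithLp.toLp 2 (W i)) j
  rw [norm_toLp_row hW] at h
  simpa using h

lemma mulVec_eq_inner (x : EuclideanSpace ℝ (Fin d)) (i : Fin k) :
    W.mulVec x.ofLp i = inner ℝ (WithLp.toLp 2 (W i)) x := by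
  simp [Matrix.mulVec, dotProduct, PiLp.inner_apply, mul_comm]

lemma continuous_toLp_mulVec (W : Matrix (Fin k) (Fin d) ℝ) :
    Continuous fun x : EuclideanSpace ℝ (Fin d) ↦ WithLp.toLp 2 (W.mulVec x.ofLp) := by
  fun_prop

/-- A displacement `z` in `ℝ^k` lifts to `Wᵀ z`, which has the same norm and satisfies `W Wᵀ z = z`.
-/
lemma supConv_comp_le_dilation {f : EuclideanSpace ℝ (Fin d) → ℝ}
    {F : EuclideanSpace ℝ (Fin k) → ℝ} (hf : IsConcept f) (hF : ∀ y, F y = -1 ∨ F y = 1)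
    (hW : W * W.transpose = 1)
    (hfF : ∀ x : EuclideanSpace ℝ (Fin d), f x = F (WithLp.toLp 2 (W.mulVec x.ofLp)))
    {ρ : ℝ} (hρ : 0 < ρ) (x : EuclideanSpace ℝ (Fin d)) :
    supConv F (2 / ρ) (WithLp.toLp 2 (W.mulVec x.ofLp)) ≤ dilation f ρ x := by
  refine supConv_le_of_forall_le hρ hF _ ?_ fun z hz ↦ ?_
  · refine le_trans ?_ (hf.le_dilation x (z := 0) (by simpa using hρ.le))
    rw [add_zero]
    rcases hf.range x with h | h <;> norm_num [h]
  · have h := hf.le_dilation x (z := WithLp.toLp 2 (W.transpose.mulVec z.ofLp))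
      (ρ := ρ) (by rwa [norm_transpose_mulVec hW])
    refine le_trans (le_of_eq ?_) h
    rw [hfF]
    congr 1
    ext i
    simp [Matrix.mulVec_add, Matrix.mulVec_mulVec, hW]

/-- Pointwise `f^{-ρ} ≤ f ≤ G ∘ W ≤ f^{+ρ}`, so `(G ∘ W - f) / 2` lies below the integrand of the
smoothness condition. -/
lemma integral_supConv_comp_le {f : EuclideanSpace ℝ (Fin d) → ℝ}
    {F : EuclideanSpace ℝ (Fin k) → ℝ} (hf : IsConcept f) (hF : ∀ y, F y = -1 ∨ F y = 1)
    (hW : W * W.transpose = 1)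
    (hfF : ∀ x : EuclideanSpace ℝ (Fin d), f x = F (WithLp.toLp 2 (W.mulVec x.ofLp)))
    {D : Measure (EuclideanSpace ℝ (Fin d))} [IsProbabilityMeasure D] {σ : ℝ} (hσ : 0 ≤ σ)
    (hs : HasSmoothBoundary f σ D) {ρ : ℝ} (hρ : 0 < ρ) :
    Integrable (fun x : EuclideanSpace ℝ (Fin d) ↦
      supConv F (2 / ρ) (WithLp.toLp 2 (W.mulVec x.ofLp))) D ∧
    ∫ x, supConv F (2 / ρ) (WithLp.toLp 2 (W.mulVec x.ofLp)) ∂D ≤ ∫ x, f x ∂D + 2 * σ * ρ := by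
  have hc : 0 ≤ 2 / ρ := by positivity
  have hint : Integrable (fun x : EuclideanSpace ℝ (Fin d) ↦
      supConv F (2 / ρ) (WithLp.toLp 2 (W.mulVec x.ofLp))) D :=
    Integrable.of_bound
      ((continuous_supConv hF hc).comp (continuous_toLp_mulVec W)).aestronglyMeasurable 1
      (.of_forall fun x ↦ abs_supConv_le_one hF hc _)
  refine ⟨hint, ?_⟩
  have hfi := hf.integrable D
  have hnn (x : EuclideanSpace ℝ (Fin d)) :
      0 ≤ (supConv F (2 / ρ) (WithLp.toLp 2 (W.mulVec x.ofLp)) - f x) / 2 := by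
    have := le_supConv hF hc (WithLp.toLp 2 (W.mulVec x.ofLp))
    rw [← hfF] at this
    linarith
  have h1 : ENNReal.ofReal (∫ x, (supConv F (2 / ρ) (WithLp.toLp 2 (W.mulVec x.ofLp)) - f x) / 2 ∂D)
      ≤ ENNReal.ofReal (σ * ρ) := by
    have hi : Integrable (fun x : EuclideanSpace ℝ (Fin d) ↦
        (supConv F (2 / ρ) (WithLp.toLp 2 (W.mulVec x.ofLp)) - f x) / 2) D :=
      (hint.sub hfi).div_const 2
    rw [ofReal_integral_eq_lintegral_ofReal hi (.of_forall hnn)]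
    refine le_trans (lintegral_mono fun x ↦ ENNReal.ofReal_le_ofReal ?_) (hs ρ hρ.le)
    have := supConv_comp_le_dilation hf hF hW hfF hρ x
    have := hf.erosion_le hρ.le x
    linarith
  rw [ENNReal.ofReal_le_ofReal_iff (by positivity), integral_div, integral_sub hint hfi] at h1
  linarith

end Projection

/-! ### Moments from strictly subexponential tails. -/

section Moments

variable {d : ℕ} {D : Measure (EuclideanSpace ℝ (Fin d))}

lemma lintegral_exp_le_of_isStrictlySubexponential [IsProbabilityMeasure D] {γ α β : ℝ}
    (hγ : 0 < γ) (hα : 0 < α) (hβ : 0 < β) (hD : IsStrictlySubexponential D γ α β)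
    {w : EuclideanSpace ℝ (Fin d)} (hw : ‖w‖ = 1) :
    ∫⁻ x, ENNReal.ofReal (Real.exp (β / 2 * |inner ℝ w x| ^ (1 + γ))) ∂D ≤
      ENNReal.ofReal (1 + α) := by
  have hcont : Continuous fun x : EuclideanSpace ℝ (Fin d) ↦
      Real.exp (β / 2 * |inner ℝ w x| ^ (1 + γ)) := by
    have : Continuous fun x : EuclideanSpace ℝ (Fin d) ↦ |inner ℝ w x| ^ (1 + γ) :=
      (by fun_prop : Continuous fun x : EuclideanSpace ℝ (Fin d) ↦ |inner ℝ w x|).rpow_const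
        fun _ ↦ Or.inr (by linarith)
    fun_prop
  rw [lintegral_eq_lintegral_meas_le D (.of_forall fun _ ↦ (Real.exp_pos _).le)
    hcont.aemeasurable]
  have hsplit : Set.Ioi (0 : ℝ) = Set.Ioc 0 1 ∪ Set.Ioi 1 :=
    (Set.Ioc_union_Ioi_eq_Ioi zero_le_one).symm
  rw [hsplit]
  refine (lintegral_union_le _ _ _).trans ?_
  rw [ENNReal.ofReal_add zero_le_one hα.le]
  refine add_le_add ?_ ?_
  · refine (lintegral_mono fun t ↦ prob_le_one).trans ?_
    simp
  · have htail : ∀ t ∈ Set.Ioi (1 : ℝ),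
        D {x | t ≤ Real.exp (β / 2 * |inner ℝ w x| ^ (1 + γ))} ≤
          ENNReal.ofReal (α * t ^ (-2 : ℝ)) := by
      intro t ht
      rw [Set.mem_Ioi] at ht
      have ht0 : 0 < t := by linarith
      have hlog : 0 < Real.log t := Real.log_pos ht
      -- Chosen so that `exp (β / 2 * r ^ (1 + γ)) = t`; the tail at `r` is then `α t⁻²`, whose
      -- integral over `t > 1` is `α`.
      set r := (2 / β * Real.log t) ^ (1 / (1 + γ)) with hr
      have hr0 : 0 ≤ r := by positivity
      have hrp : r ^ (1 + γ) = 2 / β * Real.log t := by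
        rw [hr, ← Real.rpow_mul (by positivity), one_div_mul_cancel (by positivity), Real.rpow_one]
      have hsub : {x | t ≤ Real.exp (β / 2 * |inner ℝ w x| ^ (1 + γ))} ⊆
          {x | r ≤ |inner ℝ w x|} := by
        intro x hx
        simp only [Set.mem_ofPred_eq] at hx ⊢
        rw [← Real.log_le_iff_le_exp ht0] at hx
        rw [← Real.rpow_le_rpow_iff hr0 (abs_nonneg _) (by positivity : 0 < 1 + γ), hrp]
        rw [div_mul_eq_mul_div, div_le_iff₀ hβ]
        linarith
      refine (measure_mono hsub).trans ?_
      rw [← ofReal_measureReal]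
      refine ENNReal.ofReal_le_ofReal ((hD w hw r hr0).trans (le_of_eq ?_))
      rw [hrp, Real.rpow_def_of_pos ht0]
      congr 2
      field_simp
    have hint : IntegrableOn (fun t : ℝ ↦ α * t ^ (-2 : ℝ)) (Set.Ioi 1) :=
      (integrableOn_Ioi_rpow_of_lt (by norm_num) one_pos).const_mul α
    refine (setLIntegral_mono' measurableSet_Ioi htail).trans ?_
    rw [← ofReal_integral_eq_lintegral_ofReal hint]
    · rw [integral_const_mul, integral_Ioi_rpow_of_lt (by norm_num) one_pos]
      norm_num
    · filter_upwards [ae_restrict_mem measurableSet_Ioi] with t ht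
      have : (0 : ℝ) < t := one_pos.trans ht
      positivity

/-- This is `y ≤ exp y` at `y = (c s / p) t ^ s`, raised to the power `p / s`. -/
lemma rpow_le_mul_exp {t p c s : ℝ} (ht : 0 ≤ t) (hp : 0 < p) (hc : 0 < c) (hs : 0 < s) :
    t ^ p ≤ (p / (c * s)) ^ (p / s) * Real.exp (c * t ^ s) := by
  have h1 : c * s / p * t ^ s ≤ Real.exp (c * s / p * t ^ s) := by
    have := Real.add_one_le_exp (c * s / p * t ^ s)
    linarith
  have h2 : t ^ s ≤ p / (c * s) * Real.exp (c * s / p * t ^ s) := by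
    generalize Real.exp (c * s / p * t ^ s) = E at h1 ⊢
    rw [div_mul_eq_mul_div, le_div_iff₀ (by positivity)]
    rw [div_mul_eq_mul_div, div_le_iff₀ hp] at h1
    linarith
  have h3 := Real.rpow_le_rpow (by positivity) h2 (by positivity : 0 ≤ p / s)
  rw [← Real.rpow_mul ht, mul_div_cancel₀ _ hs.ne',
    Real.mul_rpow (by positivity) (by positivity), ← Real.exp_mul] at h3
  convert h3 using 3
  field_simp

lemma integral_pow_le_of_isStrictlySubexponential [IsProbabilityMeasure D] {γ α β : ℝ}
    (hγ : 0 < γ) (hα : 0 < α) (hβ : 0 < β) (hD : IsStrictlySubexponential D γ α β)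
    {w : EuclideanSpace ℝ (Fin d)} (hw : ‖w‖ = 1) {p : ℕ} (hp : 0 < p) :
    ∫ x, |inner ℝ w x| ^ p ∂D ≤
      (p / (β / 2 * (1 + γ))) ^ ((p : ℝ) / (1 + γ)) * (1 + α) := by
  have hp' : (0 : ℝ) < p := by positivity
  have hA : 0 ≤ ((p : ℝ) / (β / 2 * (1 + γ))) ^ ((p : ℝ) / (1 + γ)) := by positivity
  rw [integral_eq_lintegral_of_nonneg_ae (.of_forall fun _ ↦ by positivity)
    (by fun_prop : Continuous fun x : EuclideanSpace ℝ (Fin d) ↦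
      |inner ℝ w x| ^ p).aestronglyMeasurable]
  refine ENNReal.toReal_le_of_le_ofReal (by positivity) ?_
  rw [ENNReal.ofReal_mul hA]
  refine le_trans ?_ (mul_le_mul_right (lintegral_exp_le_of_isStrictlySubexponential hγ hα hβ hD hw)
    _)
  rw [← lintegral_const_mul' _ _ ENNReal.ofReal_ne_top]
  refine lintegral_mono fun x ↦ ?_
  rw [← ENNReal.ofReal_mul hA, ← Real.rpow_natCast]
  exact ENNReal.ofReal_le_ofReal
    (rpow_le_mul_exp (abs_nonneg _) hp' (by positivity) (by positivity))

end Moments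

/-! ### The polynomial majorant and transfer of its expectation. -/

lemma HasCoeffBound.integrable_and_abs_sub_le {d ℓ : ℕ} {g : (Fin d → ℝ) → ℝ} {B Δ : ℝ}
    (hg : HasCoeffBound g ℓ B) {D D' : Measure (EuclideanSpace ℝ (Fin d))} (hΔ : 0 ≤ Δ)
    (h : IsMomentMatching D ℓ Δ D') :
    Integrable (fun x : EuclideanSpace ℝ (Fin d) ↦ g x.ofLp) D ∧
    Integrable (fun x : EuclideanSpace ℝ (Fin d) ↦ g x.ofLp) D' ∧
    |∫ x : EuclideanSpace ℝ (Fin d), g x.ofLp ∂D - ∫ x : EuclideanSpace ℝ (Fin d), g x.ofLp ∂D'| ≤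
      Δ * B := by
  obtain ⟨ι, _, c, a, h1, h2, h3⟩ := hg
  have e : (fun x : EuclideanSpace ℝ (Fin d) ↦ g x.ofLp) =
      fun x ↦ ∑ t, c t * monomialFun (a t) x := funext fun x ↦ h3 _
  have hi (t) := (h.integrable_left (a t) (h1 t)).const_mul (c t)
  have hi' (t) := (h.integrable_right (a t) (h1 t)).const_mul (c t)
  rw [e]
  refine ⟨integrable_finsetSum _ fun t _ ↦ hi t, integrable_finsetSum _ fun t _ ↦ hi' t, ?_⟩
  rw [integral_finsetSum _ fun t _ ↦ hi t, integral_finsetSum _ fun t _ ↦ hi' t,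
    ← Finset.sum_sub_distrib]
  calc _ ≤ ∑ t, |c t| * Δ := by
        refine (Finset.abs_sum_le_sum_abs _ _).trans (Finset.sum_le_sum fun t _ ↦ ?_)
        rw [integral_const_mul, integral_const_mul, ← mul_sub, abs_mul]
        exact mul_le_mul_of_nonneg_left (h.abs_sub_le _ (h1 t)) (abs_nonneg _)
    _ ≤ Δ * B := by
        rw [← Finset.sum_mul, mul_comm]
        exact mul_le_mul_of_nonneg_left h2 hΔ

/-- Outside the cube, the largest coordinate `u_i` has modulus above `1`. The coefficient bound
gives `|jackson q G u| ≤ (5 |u_i|) ^ m` with `m = 4kq`, and the same power absorbs `|G u| ≤ 1`. The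
exponent is even, so the other summands are nonnegative. -/
lemma abs_jackson_sub_le_add {k q : ℕ} (hq : 0 < q) {G : (Fin k → ℝ) → ℝ} {L : ℝ}
    (hL : 0 ≤ L) (hG1 : ∀ u, |G u| ≤ 1)
    (hG : ∀ u v, |G u - G v| ≤ L * √(∑ i, (u i - v i) ^ 2)) (u : Fin k → ℝ) :
    |jackson q G u - G u| ≤ L * (√(2 * k) / q) + 2 * ∑ i, (5 * u i) ^ (4 * (k * q)) := by
  have heven : Even (4 * (k * q)) := ⟨2 * (k * q), by ring⟩
  have hnn : ∀ i ∈ Finset.univ, 0 ≤ (5 * u i) ^ (4 * (k * q)) := fun i _ ↦ heven.pow_nonneg _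
  by_cases hu : ∀ i, |u i| ≤ 1
  · have h1 := abs_jackson_sub_le hq hL hG hu
    have h2 := Finset.sum_nonneg hnn
    linarith
  · push Not at hu
    obtain ⟨i₀, hi₀⟩ := hu
    obtain ⟨i, -, hi⟩ := Finset.exists_max_image Finset.univ (fun i ↦ |u i|) ⟨i₀, Finset.mem_univ _⟩
    have h1 : 1 ≤ |u i| := hi₀.le.trans (hi i₀ (Finset.mem_univ _))
    have h2 := (hasCoeffBound_jackson hq hG1).abs_le h1 fun j ↦ hi j (Finset.mem_univ j)
    have h3 := Finset.single_le_sum hnn (Finset.mem_univ i)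
    rw [← mul_pow] at h2
    rw [← heven.pow_abs, abs_mul, abs_of_pos (by norm_num : (0 : ℝ) < 5)] at h3
    have h4 : 1 ≤ (5 * |u i|) ^ (4 * (k * q)) := one_le_pow₀ (by linarith)
    have h5 : 0 ≤ L * (√(2 * k) / q) := by positivity
    have h6 := abs_sub (jackson q G u) (G u)
    have h7 := hG1 u
    linarith

lemma integral_le_integral_add_of_isMomentMatching {k d q : ℕ} (hk : 0 < k) (hkd : k ≤ d)
    (hq : 0 < q) {D D' : Measure (EuclideanSpace ℝ (Fin d))} [IsProbabilityMeasure D]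
    {f : EuclideanSpace ℝ (Fin d) → ℝ} (hf : IsConcept f) (hfk : HasIntrinsicDimension f k)
    {σ γ α β ε r Δ : ℝ} (hσ : 1 ≤ σ) (hγ : 0 < γ) (hα : 0 < α) (hβ : 0 < β) (hε : 0 < ε)
    (hε1 : ε < 1) (hr : 1 ≤ r) (hΔ : 0 ≤ Δ) (hs : HasSmoothBoundary f σ D)
    (hD : IsStrictlySubexponential D γ α β) (hm : IsMomentMatching D (4 * (k * q)) Δ D')
    (hjackson : 8 * σ / ε * r * (√(2 * k) / q) ≤ ε / 8)
    (htail : 2 * (k * ((5 / r) ^ (4 * (k * q)) *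
      (((4 * (k * q) : ℕ) / (β / 2 * (1 + γ))) ^ (((4 * (k * q) : ℕ) : ℝ) / (1 + γ)) *
        (1 + α)))) ≤ ε / 8) :
    ∫ x, f x ∂D' ≤ ∫ x, f x ∂D + ε + Δ * (4 * k * (5 * d) ^ (4 * (k * q))) := by
  obtain ⟨F, W, hF, hW, hfF⟩ := hfk
  have := hm.isProbabilityMeasure
  set m := 4 * (k * q) with hmdef
  have hmpos : 0 < m := by positivity
  have heven : Even m := ⟨2 * (k * q), by omega⟩
  have hr0 : 0 < r := by linarith
  have hσ0 : 0 < σ := by linarith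
  -- This `ρ` makes the smoothing cost `2σρ` equal to `ε / 2`.
  have hρ : 0 < ε / (4 * σ) := by positivity
  set c := 2 / (ε / (4 * σ)) with hcdef
  have hc8 : c = 8 * σ / ε := by rw [hcdef]; field_simp; ring
  have hc : 0 ≤ c := by positivity
  obtain ⟨hGint, hGle⟩ := integral_supConv_comp_le hf hF hW hfF hσ0.le hs hρ
  rw [← hcdef] at hGint hGle
  -- Rescaling by `r` turns the cube of side `2r` into the unit cube, at the price of a factor `r`
  -- in the Lipschitz constant.
  set G : (Fin k → ℝ) → ℝ := fun u ↦ supConv F c (WithLp.toLp 2 (r • u)) with hGdef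
  set U : Fin k → (Fin d → ℝ) → ℝ := fun i x ↦ W.mulVec x i / r with hU
  have hGU (x : EuclideanSpace ℝ (Fin d)) :
      G (fun i ↦ U i x.ofLp) = supConv F c (WithLp.toLp 2 (W.mulVec x.ofLp)) := by
    simp only [hGdef, hU]
    congr 2
    ext i
    simp [mul_div_cancel₀ _ hr0.ne']
  have hG1 (u) : |G u| ≤ 1 := abs_supConv_le_one hF hc _
  have hGL (u v) : |G u - G v| ≤ c * r * √(∑ i, (u i - v i) ^ 2) := by
    refine (abs_supConv_sub_le hF hc _ _).trans (le_of_eq ?_)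
    rw [← WithLp.toLp_sub, ← smul_sub, WithLp.toLp_smul, norm_smul, EuclideanSpace.norm_eq,
      Real.norm_of_nonneg hr0.le]
    simp [mul_assoc]
  set Q : (Fin k → ℝ) → ℝ := fun u ↦ 2 * ∑ i, (5 * u i) ^ m with hQdef
  have happrox (u) : |jackson q G u - G u| ≤ ε / 8 + Q u := by
    have h := abs_jackson_sub_le_add hq (by positivity : 0 ≤ c * r) hG1 hGL u
    rw [hc8] at h
    exact h.trans (add_le_add hjackson le_rfl)
  have hQ : HasCoeffBound Q m (2 * (k * 5 ^ m)) := by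
    have h := ((HasCoeffBound.sum (ℓ := m) (n := k) Finset.univ fun i _ ↦
      (((HasCoeffBound.coord i).const_mul 5).pow m).mono (by simp) le_rfl).const_mul 2)
    refine h.mono le_rfl (le_of_eq ?_)
    simp
  have hP : HasCoeffBound (fun u ↦ jackson q G u + ε / 8 + Q u) m (4 * k * 5 ^ m) := by
    refine (((hasCoeffBound_jackson hq hG1).add
      ((HasCoeffBound.const (ε / 8)).mono (Nat.zero_le _) le_rfl)).add hQ).mono le_rfl ?_
    rw [abs_of_pos (by positivity), ← hmdef]
    have h5 : (1 : ℝ) ≤ 5 ^ m := one_le_pow₀ (by norm_num)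
    have hk1 : (1 : ℝ) ≤ k := by exact_mod_cast hk
    nlinarith
  have hd1 : (1 : ℝ) ≤ d := by exact_mod_cast hk.trans_le hkd
  have hUb (i) : HasCoeffBound (U i) 1 d := by
    have h := HasCoeffBound.sum (ℓ := 1) (n := d) Finset.univ fun j _ ↦
      ((HasCoeffBound.coord j).const_mul (W i j / r)).mono le_rfl (B' := 1) (by
        rw [mul_one, abs_div, abs_of_pos hr0, div_le_one hr0]
        exact (abs_entry_le_one hW i j).trans hr)
    have e : U i = fun x ↦ ∑ j, W i j / r * x j := by
      funext x
      simp only [hU, Matrix.mulVec, dotProduct, Finset.sum_div]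
      exact Finset.sum_congr rfl fun j _ ↦ by ring
    rw [e]
    simpa using h
  obtain ⟨hPD, hPD', hPsub⟩ := (hP.comp hd1 hUb).integrable_and_abs_sub_le hΔ hm
  obtain ⟨hQD, -, -⟩ := (hQ.comp hd1 hUb).integrable_and_abs_sub_le hΔ hm
  have hQle : ∫ x : EuclideanSpace ℝ (Fin d), Q (fun i ↦ U i x.ofLp) ∂D ≤ ε / 8 := by
    have hterm (i : Fin k) (x : EuclideanSpace ℝ (Fin d)) :
        (5 * U i x.ofLp) ^ m = (5 / r) ^ m * |inner ℝ (WithLp.toLp 2 (W i)) x| ^ m := by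
      rw [heven.pow_abs, ← mul_pow, ← mulVec_eq_inner]
      simp only [hU]
      ring
    have hint (i : Fin k) : Integrable (fun x : EuclideanSpace ℝ (Fin d) ↦
        (5 * U i x.ofLp) ^ m) D :=
      (((((HasCoeffBound.coord i).const_mul 5).pow m).mono (ℓ' := m) (by simp) le_rfl).comp hd1
        hUb).integrable_and_abs_sub_le hΔ hm |>.1
    simp only [hQdef]
    rw [integral_const_mul, integral_finsetSum _ fun i _ ↦ hint i]
    refine le_trans ?_ htail
    refine mul_le_mul_of_nonneg_left ?_ zero_le_two
    calc _ ≤ ∑ i : Fin k, ((5 / r) ^ m *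
          ((m / (β / 2 * (1 + γ))) ^ ((m : ℝ) / (1 + γ)) * (1 + α))) := by
          refine Finset.sum_le_sum fun i _ ↦ ?_
          simp only [hterm]
          rw [integral_const_mul]
          exact mul_le_mul_of_nonneg_left (integral_pow_le_of_isStrictlySubexponential hγ hα hβ hD
            (norm_toLp_row hW i) hmpos) (by positivity)
      _ = _ := by simp
  have h1 : ∫ x, f x ∂D' ≤ ∫ x : EuclideanSpace ℝ (Fin d),
      (jackson q G (fun i ↦ U i x.ofLp) + ε / 8 + Q (fun i ↦ U i x.ofLp)) ∂D' := by
    refine integral_mono (hf.integrable D') hPD' fun x ↦ ?_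
    have h2 := le_supConv hF hc (WithLp.toLp 2 (W.mulVec x.ofLp))
    rw [← hfF, ← hGU] at h2
    have h3 := (abs_le.mp (happrox (fun i ↦ U i x.ofLp))).1
    simp only
    linarith
  have hGadd : Integrable (fun x : EuclideanSpace ℝ (Fin d) ↦
      supConv F c (WithLp.toLp 2 (W.mulVec x.ofLp)) + ε / 4) D := hGint.add (integrable_const _)
  -- Error budget: `ε / 2` for smoothing, `ε / 4` for twice the cube error, `ε / 4` for twice the
  -- tail term.
  have h2 : ∫ x : EuclideanSpace ℝ (Fin d),
      (jackson q G (fun i ↦ U i x.ofLp) + ε / 8 + Q (fun i ↦ U i x.ofLp)) ∂D ≤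
      ∫ x : EuclideanSpace ℝ (Fin d), (supConv F c (WithLp.toLp 2 (W.mulVec x.ofLp)) + ε / 4 +
        2 * Q (fun i ↦ U i x.ofLp)) ∂D := by
    refine integral_mono hPD (hGadd.add (hQD.const_mul 2)) fun x ↦ ?_
    have h3 := (abs_le.mp (happrox (fun i ↦ U i x.ofLp))).2
    rw [hGU] at h3
    simp only
    linarith
  rw [integral_add hGadd (hQD.const_mul 2),
    integral_add hGint (integrable_const _), integral_const_mul] at h2
  simp only [integral_const, probReal_univ, one_smul] at h2
  have h3 := (abs_le.mp hPsub).1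
  have h4 : 2 * σ * (ε / (4 * σ)) = ε / 2 := by field_simp; ring
  rw [h4] at hGle
  have h5 : 4 * (k : ℝ) * 5 ^ m * d ^ m = 4 * k * (5 * d) ^ m := by rw [mul_pow]; ring
  rw [h5] at h3
  linarith

/-! ### Choice of degree and radius. -/

lemma exists_degree_and_radius {γ α β : ℝ} (hγ : 0 < γ) (hα : 0 < α) (hβ : 0 < β) :
    ∃ C : ℝ, 0 < C ∧ ∀ k d : ℕ, 0 < k → k ≤ d → ∀ σ : ℝ, 1 ≤ σ → ∀ ε : ℝ, 0 < ε → ε < 1 →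
      ∃ (q : ℕ) (r : ℝ), 0 < q ∧ 1 ≤ r ∧
        ((4 * (k * q) : ℕ) : ℝ) ≤ softOPow C 1 γ (σ * (k : ℝ) ^ (3 / 2 : ℝ) / ε ^ 2) ∧
        4 * k * (5 * d : ℝ) ^ (4 * (k * q)) ≤
          Real.exp (softOPow C 1 γ (σ * (k : ℝ) ^ (3 / 2 : ℝ) / ε ^ 2) *
            (1 + Real.log d) ^ 1) ∧
        8 * σ / ε * r * (√(2 * k) / q) ≤ ε / 8 ∧
        2 * (k * ((5 / r) ^ (4 * (k * q)) *
          (((4 * (k * q) : ℕ) / (β / 2 * (1 + γ))) ^ (((4 * (k * q) : ℕ) : ℝ) / (1 + γ)) *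
            (1 + α)))) ≤ ε / 8 := by
  set K : ℝ := (8 / (β * (1 + γ))) ^ (1 / (1 + γ)) with hK
  have hK0 : 0 < K := by positivity
  -- Makes `5K / A ≤ 1/2`, so the tail term decays like `(1/2) ^ (4m)`.
  set A : ℝ := 1 + 10 * K with hA
  have hA1 : 1 ≤ A := by linarith
  -- The first summand serves the cube error, the second the prefactor `1 + α` of the moments.
  set C₀ : ℝ := 100 * A + (1 + α) with hC₀
  have hC₀1 : 1 ≤ C₀ := by linarith
  refine ⟨24 * C₀, by positivity, fun k d hk hkd σ hσ ε hε hε1 ↦ ?_⟩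
  have hk1 : (1 : ℝ) ≤ k := by exact_mod_cast hk
  have hd1 : (1 : ℝ) ≤ d := by exact_mod_cast hk.trans_le hkd
  have hk32 : (k : ℝ) ^ (3 / 2 : ℝ) = k * √k := by
    rw [show (3 / 2 : ℝ) = 1 + 1 / 2 by norm_num, Real.rpow_add (by positivity), Real.rpow_one,
      Real.sqrt_eq_rpow]
  set X := σ * (k : ℝ) ^ (3 / 2 : ℝ) / ε ^ 2 with hX
  have hsqk : 1 ≤ √(k : ℝ) := Real.one_le_sqrt.mpr hk1
  have hkX : (k : ℝ) / ε ≤ X := by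
    rw [hX, hk32]
    have h1 : ε ^ 2 ≤ ε := by nlinarith
    refine div_le_div₀ (by positivity) ?_ (by positivity) h1
    have : (k : ℝ) ≤ k * √k := le_mul_of_one_le_right (by positivity) hsqk
    exact this.trans (le_mul_of_one_le_left (by positivity) hσ)
  have hkX' : (k : ℝ) ≤ X := le_trans (by rw [le_div_iff₀ hε]; nlinarith) hkX
  have hX1 : 1 ≤ X := hk1.trans hkX'
  set M := (C₀ * X) ^ (1 + 1 / γ) with hM
  have hC₀X : 1 ≤ C₀ * X := one_le_mul_of_one_le_of_one_le hC₀1 hX1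
  have hMX : C₀ * X ≤ M := Real.self_le_rpow_of_one_le hC₀X (by
    have : 0 < 1 / γ := by positivity
    linarith)
  have hkM : (k : ℝ) ≤ M := hkX'.trans ((le_mul_of_one_le_left (by linarith) hC₀1).trans hMX)
  have hM0 : 0 < M := by linarith
  -- Gives `M ≤ kq ≤ 2M`; the upper bound uses `k ≤ M`.
  set q := ⌈M / k⌉₊ with hq
  have hq0 : 0 < q := Nat.ceil_pos.mpr (by positivity)
  have hMm : M ≤ k * q := by
    have := Nat.le_ceil (M / k)
    rw [div_le_iff₀ (by positivity)] at this
    rw [mul_comm]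
    exact this
  have hmM : (k : ℝ) * q ≤ 2 * M := by
    have := (Nat.ceil_lt_add_one (by positivity : 0 ≤ M / k)).le
    have h2 : (k : ℝ) * q ≤ k * (M / k + 1) := mul_le_mul_of_nonneg_left this (by positivity)
    rw [mul_add, mul_div_cancel₀ _ (by positivity)] at h2
    linarith
  set m : ℝ := k * q with hm
  have hm1 : 1 ≤ m := by linarith
  -- The factor `24` covers the exponent `12m ≤ 24M` of the coefficient bound. The logarithm of `X`
  -- is only used through `1 + log X ≥ 1`.
  have hsoft : 24 * M ≤ softOPow (24 * C₀) 1 γ X := by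
    have hlog : 0 ≤ Real.log X := Real.log_nonneg hX1
    have hexp : 1 ≤ 1 + 1 / γ := by
      have : 0 < 1 / γ := by positivity
      linarith
    calc 24 * M ≤ 24 ^ (1 + 1 / γ) * M :=
          mul_le_mul_of_nonneg_right (Real.self_le_rpow_of_one_le (by norm_num) hexp) hM0.le
      _ = (24 * C₀ * X) ^ (1 + 1 / γ) := by
          rw [hM, ← Real.mul_rpow (by norm_num) (by linarith), mul_assoc]
      _ ≤ softOPow (24 * C₀) 1 γ X := by
          refine Real.rpow_le_rpow (by positivity) ?_ (by positivity)
          rw [pow_one]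
          exact le_mul_of_one_le_right (by positivity) (by linarith)
  set r := A * m ^ (1 / (1 + γ)) with hr
  have hmr : 1 ≤ m ^ (1 / (1 + γ)) := Real.one_le_rpow hm1 (by positivity)
  have hr1 : 1 ≤ r := one_le_mul_of_one_le_of_one_le hA1 hmr
  have hr0 : 0 < r := by linarith
  refine ⟨q, r, hq0, hr1, ?_, ?_, ?_, ?_⟩
  · push_cast
    linarith
  · have hlogd : 0 ≤ Real.log d := Real.log_nonneg hd1
    have h1 : 4 * (k : ℝ) ≤ Real.exp (4 * m) := by
      have h2 := Real.add_one_le_exp (4 * m)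
      have h3 : (k : ℝ) ≤ m := by
        rw [hm]; exact le_mul_of_one_le_right (by positivity) (by exact_mod_cast hq0)
      linarith
    have h2 : 5 * (d : ℝ) ≤ Real.exp (2 + Real.log d) := by
      rw [Real.exp_add, Real.exp_log (by linarith)]
      refine mul_le_mul_of_nonneg_right ?_ (by linarith)
      have h3 := Real.exp_one_gt_d9
      have h4 : Real.exp 2 = Real.exp 1 * Real.exp 1 := by rw [← Real.exp_add]; norm_num
      nlinarith
    calc 4 * k * (5 * d : ℝ) ^ (4 * (k * q))
        ≤ Real.exp (4 * m) * Real.exp (2 + Real.log d) ^ (4 * (k * q)) := by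
          gcongr
      _ = Real.exp (12 * m + 4 * m * Real.log d) := by
          rw [← Real.exp_nat_mul, ← Real.exp_add]
          congr 1
          push_cast
          rw [← hm]
          ring
      _ ≤ _ := by
          refine Real.exp_le_exp.mpr ?_
          rw [pow_one]
          have h5 : 12 * m ≤ softOPow (24 * C₀) 1 γ X := by linarith
          have h6 := mul_le_mul_of_nonneg_right h5 (by linarith : 0 ≤ 1 + Real.log d)
          have h7 : 0 ≤ m * Real.log d := by positivity
          linarith
  · have hgrow : 100 * A * X * m ^ (1 / (1 + γ)) ≤ m := by
      -- The exponents `1 + 1/γ` and `γ / (1 + γ)` are inverse to each other; this is what fixes the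
      -- degree.
      have h1 : (C₀ * X) ≤ m ^ (γ / (1 + γ)) := by
        have h2 := Real.rpow_le_rpow hM0.le hMm (by positivity : 0 ≤ γ / (1 + γ))
        rw [hM, ← Real.rpow_mul (by linarith)] at h2
        have h3 : (1 + 1 / γ) * (γ / (1 + γ)) = 1 := by field_simp; ring
        rwa [h3, Real.rpow_one] at h2
      have h2 : 100 * A * X ≤ C₀ * X := mul_le_mul_of_nonneg_right (by linarith) (by linarith)
      calc _ ≤ m ^ (γ / (1 + γ)) * m ^ (1 / (1 + γ)) :=
            mul_le_mul_of_nonneg_right (h2.trans h1) (by positivity)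
        _ = m := by
            rw [← Real.rpow_add (by linarith)]
            have h3 : γ / (1 + γ) + 1 / (1 + γ) = 1 := by field_simp; ring
            rw [h3, Real.rpow_one]
    have h2 : √(2 * k : ℝ) ≤ 3 / 2 * √k := by
      rw [Real.sqrt_mul zero_le_two]
      refine mul_le_mul_of_nonneg_right ?_ (by positivity)
      rw [Real.sqrt_le_left (by norm_num)]
      norm_num
    have hq0' : (0 : ℝ) < q := by exact_mod_cast hq0
    have hk0 : (0 : ℝ) < k := by linarith
    have h3 : 100 * σ * √k * r ≤ ε ^ 2 * q := by
      have h4 : 100 * A * X * m ^ (1 / (1 + γ)) = k * (100 * σ * √k * r) / ε ^ 2 := by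
        rw [hX, hk32, hr]; field_simp
      rw [h4, div_le_iff₀ (by positivity), hm, mul_assoc (k : ℝ) (q : ℝ)] at hgrow
      have := le_of_mul_le_mul_left hgrow hk0
      linarith
    calc 8 * σ / ε * r * (√(2 * k) / q) ≤ 8 * σ / ε * r * (3 / 2 * √k / q) := by gcongr
      _ = 12 / 100 * (100 * σ * √k * r) / (ε * q) := by field_simp; ring
      _ ≤ 12 / 100 * (ε ^ 2 * q) / (ε * q) := by gcongr
      _ = 12 / 100 * ε := by field_simp
      _ ≤ ε / 8 := by linarith
  · have h1 : ((4 * (k * q) : ℕ) / (β / 2 * (1 + γ))) ^ (((4 * (k * q) : ℕ) : ℝ) / (1 + γ)) =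
        (K * m ^ (1 / (1 + γ))) ^ (4 * (k * q)) := by
      rw [hK, ← Real.mul_rpow (by positivity) (by positivity), ← Real.rpow_natCast,
        ← Real.rpow_mul (by positivity)]
      congr 1
      · push_cast
        rw [← hm]
        field_simp
        ring
      · ring
    have h2 : 5 / r * (K * m ^ (1 / (1 + γ))) ≤ 1 / 2 := by
      rw [div_mul_eq_mul_div, div_le_iff₀ hr0, hr, hA]
      have : 0 < m ^ (1 / (1 + γ)) := by linarith
      nlinarith
    rw [h1, ← mul_assoc (_ ^ _), ← mul_pow]
    have h3 : (5 / r * (K * m ^ (1 / (1 + γ)))) ^ (4 * (k * q)) ≤ 1 / (16 * m) := by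
      refine (pow_le_pow_left₀ (by positivity) h2 _).trans ?_
      rw [pow_mul, show ((1 : ℝ) / 2) ^ 4 = 1 / 16 by norm_num, one_div_pow]
      refine one_div_le_one_div_of_le (by positivity) ?_
      have h4 : 16 * (k * q) ≤ 16 ^ (k * q) := by
        obtain ⟨p, hp⟩ := Nat.exists_eq_succ_of_ne_zero (Nat.mul_pos hk hq0).ne'
        have := Nat.lt_pow_self (n := p) (a := 16) (by norm_num)
        rw [hp, Nat.succ_eq_add_one, pow_succ]
        omega
      rw [hm]
      exact_mod_cast h4
    have h4 : (1 + α) * (k / ε) ≤ m := by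
      have h5 : (1 + α) * (k / ε) ≤ C₀ * X :=
        mul_le_mul (by linarith) hkX (by positivity) (by linarith)
      linarith
    calc _ ≤ 2 * ((k : ℝ) * (1 / (16 * m) * (1 + α))) := by gcongr
      _ = (1 + α) * (k / ε) * ε / (8 * m) := by field_simp; ring
      _ ≤ m * ε / (8 * m) := by gcongr
      _ = ε / 8 := by field_simp

/-! ### Conclusion. -/

lemma HasIntrinsicDimension.neg {d k : ℕ} {f : EuclideanSpace ℝ (Fin d) → ℝ}
    (h : HasIntrinsicDimension f k) : HasIntrinsicDimension (fun x ↦ -f x) k := by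
  obtain ⟨F, W, hF, hW, hfF⟩ := h
  exact ⟨fun y ↦ -F y, W, fun y ↦ by rcases hF y with h | h <;> simp [h], hW,
    fun x ↦ by simp only [hfF]⟩

theorem theorem5p11 :
    ∃ c : ℕ, ∀ γ α β : ℝ, 0 < γ → 0 < α → 0 < β → ∃ C : ℝ, 0 < C ∧
      ∀ (k d : ℕ), k ≤ d → ∀ σ : ℝ, 1 ≤ σ →
      ∀ (D : Measure (EuclideanSpace ℝ (Fin d))), IsProbabilityMeasure D →
      ∀ 𝓕 : Set (EuclideanSpace ℝ (Fin d) → ℝ), IsValidInstance 𝓕 D k σ γ α β →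
      ∀ ε : ℝ, 0 < ε → ε < 1 →
        ∃ (ℓ : ℕ) (B : ℝ),
          (ℓ : ℝ) ≤ softOPow C c γ (σ * (k : ℝ) ^ (3 / 2 : ℝ) / ε ^ 2) ∧
          0 ≤ B ∧
          B ≤ Real.exp (softOPow C c γ (σ * (k : ℝ) ^ (3 / 2 : ℝ) / ε ^ 2) *
            (1 + Real.log d) ^ c) ∧
          ∀ Δ : ℝ, 0 ≤ Δ → MomentMatchingFools 𝓕 D ℓ Δ (ε + Δ * B) := by
  refine ⟨1, fun γ α β hγ hα hβ ↦ ?_⟩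
  obtain ⟨C, hC, hparam⟩ := exists_degree_and_radius hγ hα hβ
  refine ⟨C, hC, fun k d hkd σ hσ D hDp 𝓕 hV ε hε hε1 ↦ ?_⟩
  rcases Nat.eq_zero_or_pos k with rfl | hk
  -- For `k = 0` the concept is constant, so degree `0` and `B = 0` suffice.
  · refine ⟨0, 0, ?_, le_rfl, (Real.exp_pos _).le, fun Δ hΔ D' hm f hf ↦ ?_⟩
    · have : (0 : ℝ) < 1 + 1 / γ := by positivity
      simpa [softOPow] using Real.rpow_nonneg le_rfl _
    · have := hm.isProbabilityMeasure
      obtain ⟨F, W, -, -, hfF⟩ := hV.intrinsicDimension f hf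
      have e (x) : f x = F 0 := by rw [hfF]; congr 1; exact Subsingleton.elim _ _
      simp only [e, integral_const, probReal_univ, one_smul, sub_self, abs_zero]
      linarith
  · obtain ⟨q, r, hq, hr, hℓ, hB, hjackson, htail⟩ := hparam k d hk hkd σ hσ ε hε hε1
    refine ⟨4 * (k * q), 4 * k * (5 * d) ^ (4 * (k * q)), hℓ, by positivity, hB,
      fun Δ hΔ D' hm f hf ↦ ?_⟩
    have hfc := hV.isConcept f hf
    have hfk := hV.intrinsicDimension f hf
    have hfs := hV.smoothBoundary f hf
    have h1 := integral_le_integral_add_of_isMomentMatching hk hkd hq hfc hfk hσ hγ hα hβ hε hε1 hr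
      hΔ hfs hV.subexponential hm hjackson htail
    -- A majorant of `-f` is a minorant of `f`, which gives the other side of the absolute value.
    have h2 := integral_le_integral_add_of_isMomentMatching hk hkd hq hfc.neg hfk.neg hσ hγ hα hβ hε
      hε1 hr hΔ hfs.neg hV.subexponential hm hjackson htail
    rw [integral_neg, integral_neg] at h2
    rw [abs_le]
    constructor <;> linarith
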